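/- Let $A$ be a separable C*-algebra. For an irreducible representation $\rho$ of $A$ and $a\in A$ let $w_a(\operatorname{Ker}\rho)=\operatorname{rank}\rho(a)\in\mathbb N\cup\{\infty\}$, a function on the primitive spectrum $\operatorname{Prim}(A)$ with the Jacobson topology. *Order and rank of a function.* For a topological space $X$ and $w:X\to\mathbb N\cup\{\infty\}$ define the order $o_w(x)$ by recursion: $o_w(x)\le\alpha$ if and only if there are a neighbourhood $U$ of $x$ and $n\in\mathbb N$ such that every $y\in U$ satisfies $o_w(y)<\alpha$ or $w(y)\le n$; if this holds for no ordinal $\alpha$, then $o_w(x)=\infty$. Put $r_w(x)=\omega\cdot o_w(x)+w(x)$ (which is $\infty$ if $o_w(x)=\infty$) and $r(w)=\sup_{x\in X} r_w(x)$. *Pedersen rank.* $r_P(a)=r(w_a)$ for $a\in A$, and $r_P(A)=\sup_{a\in A}r_P(a)$. The algebra $A$ is *$\alpha$-subhomogeneous* if $r_P(A)\le\alpha$, and *type $I_\alpha$* if the closed two-sided ideal generated by $\{a\in A: r_P(a)\le 1+\alpha\}$ is all of $A$. *Fell rank.* The Fell rank of an irreducible representation $\pi$ is the least $r(w_b|_U)$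 over all $b\in A$ and all open $U\ni\operatorname{Ker}\pi$ in $\operatorname{Prim}(A)$ such that $\rho(b)\ne0$ whenever $\operatorname{Ker}\rho\in U$; the Fell rank $r_F(A)$ is the supremum of the Fell ranks of the irreducible representations of $A$. Call $A$ *scattered* if its spectrum (the set of unitary equivalence classes of irreducible representations) is countable, and *preliminary* if every irreducible representation of $A$ is finite-dimensional. *Lazar algebras.* For a C*-algebra $B$ that is non-unital, let $B^{\dagger\dagger}=M_2(B)\oplus D_2(\mathbb C)$, where $D_2(\mathbb C)\subseteq M_2(\mathbb C)$ are the diagonal matrices, regarded as a C*-subalgebra of $M_2(B^\dagger)$ with $B^\dagger$ the unitization of $B$. For every countable ordinal $\alpha>0$ choose a sequence $(\alpha_n)_{n\ge1}$ that is constantly $\gamma$ if $\alpha=\gamma+1$ and strictly increasing with supremum $\alpha$ if $\alpha$ is a limit ordinal. Let $L_0=\mathbb C$, and for $\alpha>0$ let $L_\alpha=B^{\dagger\dagger}$, where $B$ is the $c_0$-sum of the algebras $L_{\alpha_n}\otimes M_n(\mathbb C)$, $n\ge1$. **Theorem.** Let $\alpha$ be a countable ordinal. 1. There is a separable, scattered,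 preliminary C*-algebra that is type $I_\alpha$ and is not type $I_\beta$ for any $\beta<\alpha$. 2. There is a separable, scattered, preliminary C*-algebra that is $\alpha$-subhomogeneous and is not $\beta$-subhomogeneous for any $\beta<\alpha$. 3. For every choice of the sequences $(\alpha_n)$, the unital C*-algebra $L_\alpha$ is separable, scattered and preliminary, and for every integer $d\ge1$ the Pedersen rank of $L_\alpha\otimes M_d(\mathbb C)$ is $\omega\alpha+d$. 4. For every integer $d\ge1$ there is a unital, separable, scattered, preliminary C*-algebra whose Fell rank and Pedersen rank are both equal to $\omega\alpha+d$. -/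

import Mathlib

open Topology Filter Ordinal
open scoped ENNReal

universe u

/-! ### Irreducible representations, the spectrum and the primitive spectrum -/

/-- An irreducible representation of a C*-algebra `A`: a nonzero `*`-homomorphism into the bounded
operators of a complex Hilbert space, without closed invariant subspaces besides `0` and the
whole space. -/
structure IrrRep (A : Type u) [NonUnitalCStarAlgebra A] : Type (u + 1) where
  space : Type u
  [normedAddCommGroup : NormedAddCommGroup space]
  [innerProductSpace : InnerProductSpace ℂ space]
  [completeSpace : CompleteSpace space]
  toHom : A →⋆ₙₐ[ℂ] (space →L[ℂ] space)
  ne_zero : ∃ a, toHom a ≠ 0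
  irreducible : ∀ K : Submodule ℂ space, IsClosed (K : Set space) →
    (∀ a, ∀ v ∈ K, toHom a v ∈ K) → K = ⊥ ∨ K = ⊤

attribute [instance] IrrRep.normedAddCommGroup IrrRep.innerProductSpace IrrRep.completeSpace

namespace IrrRep

variable {A : Type u} [NonUnitalCStarAlgebra A]

/-- The kernel of an irreducible representation. -/
noncomputable def ker (ρ : IrrRep A) : TwoSidedIdeal A := TwoSidedIdeal.ker ρ.toHom

theorem mem_ker (ρ : IrrRep A) (a : A) : a ∈ ρ.ker ↔ ρ.toHom a = 0 := TwoSidedIdeal.mem_ker _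

/-- Unitary equivalence. -/
def Equivalent (ρ σ : IrrRep A) : Prop :=
  ∃ U : ρ.space ≃ₗᵢ[ℂ] σ.space, ∀ a v, U (ρ.toHom a v) = σ.toHom a (U v)

variable (A) in
/-- Unitary equivalence as a setoid. -/
def setoid : Setoid (IrrRep A) where
  r := Equivalent
  iseqv :=
    { refl := fun _ => ⟨LinearIsometryEquiv.refl ℂ _, fun _ _ => rfl⟩
      symm := by
        rintro ρ σ ⟨U, hU⟩
        refine ⟨U.symm, fun a v => ?_⟩
        apply U.injective
        simp [hU]
      trans := by
        rintro ρ σ τ ⟨U, hU⟩ ⟨V, hV⟩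
        exact ⟨U.trans V, fun a v => by simp [hU, hV]⟩ }

/-- The rank (dimension of the range) of the operator `ρ a`, in `ℕ ∪ {∞}`. -/
noncomputable def opRank (ρ : IrrRep A) (a : A) : ℕ∞ :=
  Cardinal.toENat (LinearMap.rank (ρ.toHom a : ρ.space →ₗ[ℂ] ρ.space))

/-- The kernel of an irreducible representation is a prime ideal. -/
theorem ker_prime (ρ : IrrRep A) {I J : TwoSidedIdeal A} (h : I ⊓ J ≤ ρ.ker) :
    I ≤ ρ.ker ∨ J ≤ ρ.ker := by
  by_contra! hc
  obtain ⟨hI, hJ⟩ := hc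
  obtain ⟨a, haI, ha⟩ := Set.not_subset.1 hI
  apply hJ
  let K : Submodule ℂ ρ.space :=
    (Submodule.span ℂ {v | ∃ x ∈ I, ∃ w, ρ.toHom x w = v}).topologicalClosure
  have hsub : ∀ x ∈ I, ∀ w, ρ.toHom x w ∈ K := fun x hx w =>
    Submodule.le_topologicalClosure _ (Submodule.subset_span ⟨x, hx, w, rfl⟩)
  -- a closed subspace containing the generators contains `K`
  have hind : ∀ L : Submodule ℂ ρ.space, IsClosed (L : Set ρ.space) →
      (∀ x ∈ I, ∀ w, ρ.toHom x w ∈ L) → K ≤ L := by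
    intro L hL hx
    refine Submodule.topologicalClosure_minimal _ (Submodule.span_le.2 ?_) hL
    rintro v ⟨x, hxI, w, rfl⟩
    exact hx x hxI w
  have hK : K = ⊥ ∨ K = ⊤ := by
    refine ρ.irreducible K (Submodule.isClosed_topologicalClosure _) fun b v hv => ?_
    have := hind (K.comap (ρ.toHom b : ρ.space →ₗ[ℂ] ρ.space))
      ((Submodule.isClosed_topologicalClosure _).preimage (ρ.toHom b).continuous) (by
        intro x hx w
        have h2 := hsub (b * x) (I.mul_mem_left _ _ hx) w
        rw [map_mul] at h2
        exact h2)
    exact this hv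
  rcases hK with hK | hK
  · exact (ha ((ρ.mem_ker a).2 (by
      ext w
      have := hsub a haI w
      rw [hK] at this
      simpa using this))).elim
  · intro b hb
    have h3 := hind (LinearMap.ker (ρ.toHom b : ρ.space →ₗ[ℂ] ρ.space))
      ((ρ.toHom b).isClosed_ker) (by
        intro x hx w
        have h4 : b * x ∈ ρ.ker :=
          h ((TwoSidedIdeal.mem_inf A).2 ⟨I.mul_mem_left _ _ hx, J.mul_mem_right _ _ hb⟩)
        rw [mem_ker, map_mul] at h4
        exact DFunLike.congr_fun h4 w)
    refine (ρ.mem_ker b).2 ?_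
    ext w
    have : w ∈ K := hK ▸ Submodule.mem_top
    exact h3 this

end IrrRep

section CStar

variable (A : Type u) [NonUnitalCStarAlgebra A]

/-- The spectrum: unitary equivalence classes of irreducible representations. -/
def CStarSpectrum : Type (u + 1) := Quotient (IrrRep.setoid A)

/-- A separable C*-algebra is scattered if its spectrum is countable. -/
def IsScattered : Prop := Countable (CStarSpectrum A)

/-- No infinite-dimensional irreducible representations. -/
def IsPreliminary : Prop := ∀ ρ : IrrRep A, FiniteDimensional ℂ ρ.space

/-- The set of primitive ideals. -/
def PrimSpectrum : Type u := {t : TwoSidedIdeal A // ∃ ρ : IrrRep A, ρ.ker = t}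

variable {A}

/-- The point of the primitive spectrum given by an irreducible representation. -/
noncomputable def IrrRep.toPrim (ρ : IrrRep A) : PrimSpectrum A := ⟨ρ.ker, ρ, rfl⟩

/-- The primitive ideals containing `I`. (`I` and its closure have the same hull.) -/
def hull (I : TwoSidedIdeal A) : Set (PrimSpectrum A) := {t | I ≤ t.1}

/-- The Jacobson topology: the closed sets are the hulls of ideals. -/
instance : TopologicalSpace (PrimSpectrum A) :=
  TopologicalSpace.ofClosed {S | ∃ I : TwoSidedIdeal A, S = hull I}
    ⟨⊤, by
      refine (Set.eq_empty_iff_forall_notMem.2 fun (t : PrimSpectrum A) (ht : ⊤ ≤ t.1) => ?_).symm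
      obtain ⟨ρ, hρ⟩ := t.2
      obtain ⟨a, ha⟩ := ρ.ne_zero
      rw [← hρ] at ht
      exact ha ((ρ.mem_ker a).1 (ht (TwoSidedIdeal.mem_top A)))⟩
    (by
      intro S hS
      refine ⟨sSup {I | hull I ∈ S}, ?_⟩
      ext t
      constructor
      · intro h
        exact sSup_le (α := TwoSidedIdeal A) fun I hI => Set.mem_sInter.1 h _ hI
      · intro h
        refine Set.mem_sInter.2 fun T hT => ?_
        obtain ⟨I, rfl⟩ := hS hT
        exact (le_sSup (α := TwoSidedIdeal A) hT).trans h)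
    (by
      rintro _ ⟨I, rfl⟩ _ ⟨J, rfl⟩
      refine ⟨I ⊓ J, ?_⟩
      ext t
      constructor
      · rintro (h | h)
        · exact (inf_le_left (a := I) (b := J)).trans h
        · exact (inf_le_right (a := I) (b := J)).trans h
      · intro (h : I ⊓ J ≤ t.1)
        obtain ⟨ρ, hρ⟩ := t.2
        rw [← hρ] at h
        have := ρ.ker_prime h
        rw [hρ] at this
        exact this)

end CStar

/-! ### Order and rank of a function with values in `ℕ ∪ {∞}` -/

section Weight

variable {X : Type u} [TopologicalSpace X]

/-- `x` has order at most `α` with respect to `w`: on some neighbourhood of `x`, the function `w`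
is bounded by a natural number away from the points of order less than `α`. Equivalently, the ranks
of the points of some neighbourhood of `x` are at most `ω · α + n` for some natural number `n`. -/
def OrderLE (w : X → ℕ∞) (α : Ordinal.{u}) (x : X) : Prop :=
  ∃ U ∈ 𝓝 x, ∃ n : ℕ, ∀ y ∈ U, (∃ γ, ∃ _ : γ < α, OrderLE w γ y) ∨ w y ≤ n
termination_by α

/-- The order `o_w(x)`: the least `α` with `OrderLE w α x`, and `∞` if there is none. -/
noncomputable def pointOrder (w : X → ℕ∞) (x : X) : WithTop Ordinal.{u} :=
  sInf {o | ∃ α : Ordinal.{u}, o = α ∧ OrderLE w α x}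

/-- The rank `r_w(x) = ω · o_w(x) + w(x)`, which is `∞` if `o_w(x)` is. -/
noncomputable def pointRank (w : X → ℕ∞) (x : X) : WithTop Ordinal.{u} :=
  WithTop.map (fun o => ω * o) (pointOrder w x) + WithTop.map (fun n : ℕ => (n : Ordinal.{u})) (w x)

/-- The rank `r(w)`, the supremum of the ranks of the points. -/
noncomputable def weightRank (w : X → ℕ∞) : WithTop Ordinal.{u} := ⨆ x, pointRank w x

end Weight

/-! ### Pedersen rank, Fell rank, and the two hierarchies -/

section Ranks

variable {A : Type u} [NonUnitalCStarAlgebra A]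

/-- The Pedersen function `Ker ρ ↦ rank (ρ a)` of `a`. (The value does not depend on the irreducible
representation with the given kernel.) -/
noncomputable def pedersenFun (a : A) (t : PrimSpectrum A) : ℕ∞ := t.2.choose.opRank a

/-- The Pedersen rank of an element. -/
noncomputable def elementPedersenRank (a : A) : WithTop Ordinal.{u} := weightRank (pedersenFun a)

variable (A) in
/-- The Pedersen rank of a C*-algebra. -/
noncomputable def pedersenRank : WithTop Ordinal.{u} := ⨆ a : A, elementPedersenRank a

/-- `(b, U)` is a local section around `ρ`: `U` is an open set of primitive ideals that contains
`Ker ρ`, and no irreducible representation with kernel in `U` annihilates `b`. -/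
def IsLocalSection (ρ : IrrRep A) (b : A) (U : Set (PrimSpectrum A)) : Prop :=
  IsOpen U ∧ ρ.toPrim ∈ U ∧ ∀ σ : IrrRep A, σ.toPrim ∈ U → σ.toHom b ≠ 0

/-- The Fell rank of `(b, U)`: the rank of `Ker σ ↦ rank (σ b)` on the subspace `U`. -/
noncomputable def sectionFellRank (b : A) (U : Set (PrimSpectrum A)) : WithTop Ordinal.{u} :=
  weightRank fun t : U => pedersenFun b t

/-- The Fell rank of an irreducible representation. -/
noncomputable def IrrRep.fellRank (ρ : IrrRep A) : WithTop Ordinal.{u} :=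
  sInf {r | ∃ b U, IsLocalSection ρ b U ∧ r = sectionFellRank b U}

variable (A) in
/-- The Fell rank of a C*-algebra. -/
noncomputable def fellRank : WithTop Ordinal.{u} := ⨆ ρ : IrrRep A, ρ.fellRank

variable (A) in
/-- The Fell ideal of rank `α`: the closed ideal generated by the elements of Pedersen rank at most
`α`. -/
def fellIdeal (α : Ordinal.{u}) : Set A :=
  closure (TwoSidedIdeal.span {a : A | elementPedersenRank a ≤ α} : Set A)

variable (A) in
/-- `A` is type `I_α`. -/
def IsTypeI (α : Ordinal.{u}) : Prop := fellIdeal A (1 + α) = Set.univ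

variable (A) in
/-- `A` is `α`-subhomogeneous. -/
def IsSubhomogeneous (α : Ordinal.{u}) : Prop := pedersenRank A ≤ α

end Ranks

/-! ### Matrix algebras, `c₀`-sums, the bi-unitization and the Lazar algebras -/

/-- The C*-algebra `M_n(A) = A ⊗ M_n(ℂ)`. -/
def MatAlg (n : ℕ) (A : Type u) [CStarAlgebra A] : Type u := CStarMatrix (Fin n) (Fin n) A

noncomputable instance (n : ℕ) (A : Type u) [CStarAlgebra A] : CStarAlgebra (MatAlg n A) :=
  letI : PartialOrder A := CStarAlgebra.spectralOrder A
  letI : StarOrderedRing A := CStarAlgebra.spectralOrderedRing A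
  inferInstanceAs (CStarAlgebra (CStarMatrix (Fin n) (Fin n) A))

/-- The `c₀`-sum of a sequence of C*-algebras: the sequences whose norms converge to `0`. -/
def c0Sum (A : ℕ → Type u) [∀ n, NonUnitalCStarAlgebra (A n)] :
    NonUnitalStarSubalgebra ℂ (lp A ∞) where
  carrier := {x | Tendsto (fun n => ‖x n‖) atTop (𝓝 0)}
  zero_mem' := by simp
  add_mem' := by
    intro x y hx hy
    refine squeeze_zero (fun _ => norm_nonneg _) (fun n => norm_add_le (x n) (y n)) ?_
    simpa using Tendsto.add hx hy
  mul_mem' := by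
    intro x y hx hy
    refine squeeze_zero (fun _ => norm_nonneg _) (fun n => norm_mul_le (x n) (y n)) ?_
    simpa using Tendsto.mul hx hy
  smul_mem' := by
    intro c x hx
    refine squeeze_zero (fun _ => norm_nonneg _) (fun n => (norm_smul c (x n)).le) ?_
    simpa using Tendsto.const_mul ‖c‖ hx
  star_mem' := by
    intro x hx
    refine hx.congr fun n => ?_
    exact (norm_star (x n)).symm

instance (A : ℕ → Type u) [∀ n, NonUnitalCStarAlgebra (A n)] :
    IsClosed (c0Sum A : Set (lp A ∞)) := by
  refine isClosed_of_closure_subset fun x hx => ?_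
  rw [Metric.mem_closure_iff] at hx
  refine Metric.tendsto_atTop.2 fun ε hε => ?_
  obtain ⟨y, hy, hxy⟩ := hx (ε / 2) (half_pos hε)
  obtain ⟨N, hN⟩ := Metric.tendsto_atTop.1 (show Tendsto (fun n => ‖y n‖) atTop (𝓝 0) from hy)
    (ε / 2) (half_pos hε)
  refine ⟨N, fun n hn => ?_⟩
  have h1 := hN n hn
  have h2 : ‖(x - y) n‖ ≤ ‖x - y‖ := lp.norm_apply_le_norm ENNReal.top_ne_zero _ n
  rw [dist_eq_norm] at hxy
  simp only [dist_zero_right, norm_norm] at h1 ⊢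
  have h3 : ‖x n‖ ≤ ‖(x - y) n‖ + ‖y n‖ := by
    have := norm_add_le ((x - y) n) (y n)
    simpa using this
  linarith

/-- The `(i, j)` entry of a matrix. -/
def MatAlg.entry {n : ℕ} {A : Type u} [CStarAlgebra A] (x : MatAlg n A) (i j : Fin n) : A :=
  (show CStarMatrix (Fin n) (Fin n) A from x) i j

/-- The bi-unitization `B^{††} = M₂(B) ⊕ D₂(ℂ)` of a non-unital C*-algebra `B`, realized in the
`2 × 2` matrices over the unitization `ℂ ⊕ B` as the set of matrices whose off-diagonal entries
have scalar part zero. -/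
noncomputable def biUnitization (B : Type u) [NonUnitalCStarAlgebra B] :
    StarSubalgebra ℂ (MatAlg 2 (Unitization ℂ B)) where
  carrier := {x | (x.entry 0 1).fst = 0 ∧ (x.entry 1 0).fst = 0}
  mul_mem' := by
    rintro x y ⟨h1, h2⟩ ⟨h3, h4⟩
    have h (i j : Fin 2) :
        (x * y).entry i j = x.entry i 0 * y.entry 0 j + x.entry i 1 * y.entry 1 j := by
      change (∑ k, x.entry i k * y.entry k j) = _
      rw [Fin.sum_univ_two]
    simp [h, h1, h2, h3, h4]
  add_mem' := by
    rintro x y ⟨h1, h2⟩ ⟨h3, h4⟩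
    have h (i j : Fin 2) : (x + y).entry i j = x.entry i j + y.entry i j := rfl
    simp [h, h1, h2, h3, h4]
  algebraMap_mem' := by
    intro c
    have h (i j : Fin 2) : (algebraMap ℂ (MatAlg 2 (Unitization ℂ B)) c).entry i j =
        if i = j then algebraMap ℂ (Unitization ℂ B) c else 0 :=
      Matrix.algebraMap_matrix_apply
    simp [h]
  star_mem' := by
    rintro x ⟨h1, h2⟩
    have h (i j : Fin 2) : (star x).entry i j = star (x.entry j i) := rfl
    simp [h, h1, h2]

instance (B : Type u) [NonUnitalCStarAlgebra B] :
    IsClosed (biUnitization B : Set (MatAlg 2 (Unitization ℂ B))) := by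
  have h (i j : Fin 2) :
      Continuous fun x : MatAlg 2 (Unitization ℂ B) => (x.entry i j).fst := by
    refine Unitization.continuous_fst.comp ?_
    exact continuous_apply_apply (ρ := fun _ _ => Unitization ℂ B) i j
  exact (isClosed_eq (h 0 1) continuous_const).inter (isClosed_eq (h 1 0) continuous_const)

/-- The Lazar jump `(⨁ A_n)^{††}` of a sequence of C*-algebras. -/
def LazarJump (A : ℕ → Type u) [∀ n, NonUnitalCStarAlgebra (A n)] : Type u :=
  biUnitization (c0Sum A)

noncomputable instance (A : ℕ → Type u) [∀ n, NonUnitalCStarAlgebra (A n)] :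
    CStarAlgebra (LazarJump A) :=
  inferInstanceAs (CStarAlgebra (biUnitization (c0Sum A)))

/-- A unital C*-algebra with its carrier type. -/
structure BundledCStarAlgebra where
  carrier : Type
  [str : CStarAlgebra carrier]

attribute [instance] BundledCStarAlgebra.str

/-- `s` assigns to every countable ordinal `α > 0` the sequence `(α_n)` used at stage `α`: it is
constantly `γ` if `α = γ + 1`, and strictly increasing to `α` if `α` is a limit ordinal. -/
structure IsFundamentalSystem (s : Ordinal.{0} → ℕ → Ordinal.{0}) : Prop where
  succ : ∀ γ < ω₁, ∀ n, s (γ + 1) n = γ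
  limit_strictMono : ∀ α < ω₁, Order.IsSuccLimit α → StrictMono (s α)
  limit_isLUB : ∀ α < ω₁, Order.IsSuccLimit α → IsLUB (Set.range (s α)) α

open scoped Classical in
/-- The Lazar algebras: `L_0 = ℂ`, and `L_α` is the Lazar jump of `(L_{α_n} ⊗ M_n)` over `n ≥ 1`.
(The side condition in the recursion holds for every countable `α > 0` if `s` is a fundamental
system.) -/
noncomputable def lazarAlgebra (s : Ordinal.{0} → ℕ → Ordinal.{0}) (α : Ordinal.{0}) :
    BundledCStarAlgebra :=
  if h : α ≠ 0 ∧ ∀ n, s α n < α then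
    ⟨LazarJump fun n => MatAlg (n + 1) (lazarAlgebra s (s α n)).carrier⟩
  else ⟨ℂ⟩
termination_by α
decreasing_by all_goals exact h.2 _

/-- The side condition in `lazarAlgebra` holds. -/
theorem IsFundamentalSystem.lt {s : Ordinal.{0} → ℕ → Ordinal.{0}} (hs : IsFundamentalSystem s)
    {α : Ordinal.{0}} (hα : α < ω₁) (h0 : α ≠ 0) (n : ℕ) : s α n < α := by
  rcases Ordinal.zero_or_succ_or_isSuccLimit α with h | ⟨γ, rfl⟩ | h
  · exact (h0 h).elim
  · rw [Order.succ_eq_add_one] at *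
    rw [hs.succ γ ((Order.lt_add_one_iff.2 le_rfl).trans hα)]
    exact Order.lt_add_one_iff.2 le_rfl
  · exact (hs.limit_strictMono α hα h n.lt_succ_self).trans_le
      ((hs.limit_isLUB α hα h).1 ⟨_, rfl⟩)

/-!
In a unital C*-algebra `A` the function `w_1`, which sends a primitive ideal to the dimension of the
representation, dominates all functions `w_a`, and `w_a = w_1` if `a` is invertible. All ranks are
therefore governed by the dimension function on the primitive spectrum. The order of a point is a
local notion, so it is preserved by continuous open maps between primitive spectra
(`orderLE_comp_iff`), in particular by the inclusion of the spectrum of an ideal.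

All algebras that occur are glued from orthogonal unital ideals `C i`, which are also quotients, and
from finitely many boundary quotients `Q j` at which the spectra of the `C i` accumulate. This is
`BoundaryDecomposition`. Kernels of irreducible representations are prime, so every irreducible
representation factors through some `C i` or `Q j` (`BoundaryDecomposition.exists_factor`), and no
classification of the irreducible representations of the whole algebra is needed. A decomposition of
`A` induces one of the matrix algebras over `A`, and the Lazar jump of `(A n)` decomposes into the
ideals `M₂(A n)` and two characters.

The ideals of `L_α ⊗ M_d` are matrix algebras over `L_{α_n}` of sizes that tend to infinity, and its
boundary algebras are two copies of `M_d(ℂ)`. By induction on `α` (`lazarAlgebra_hasMatrixLevels`),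
the dimension function is at most `d` at the points of order at least `α`, and it is equal to `d` at
the boundary points, whose order is exactly `α`: every neighbourhood of a boundary point contains
almost all of the ideals, where the dimension is unbounded on points whose orders approach `α`. Hence
the Pedersen rank is `ω * α + d`.

For the Fell rank, let `X = L_α ⊗ M_d` and adjoin a unit to the `c₀`-sum of countably many copies
of `X`. An element that does not vanish at infinity has invertible coordinates near infinity, so
its rank on every neighbourhood of infinity is the full rank `ω * α + d`
(`exists_le_fellRank_unitization`). The `c₀`-sum of such algebras, for all successor ordinals
`ω * β + d ≤ α`, has Pedersen rank at most `α`, and the Fell ranks of its irreducible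
representations exceed every ordinal below `α` (`exists_algebra_of_rank`). An irreducible
representation whose Fell rank exceeds `γ` annihilates the Fell ideal of rank `γ`
(`fellIdeal_ne_univ`), which makes the two hierarchies strict.
-/

/-! ### Order and rank of weight functions -/

section Weight

variable {X Y : Type u} [TopologicalSpace X] [TopologicalSpace Y]

theorem orderLE_iff {w : X → ℕ∞} {α : Ordinal.{u}} {x : X} :
    OrderLE w α x ↔ ∃ U ∈ 𝓝 x, ∃ n : ℕ, ∀ y ∈ U, (∃ γ < α, OrderLE w γ y) ∨ w y ≤ n := by
  rw [OrderLE]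
  simp only [exists_prop]

theorem OrderLE.mono_left {v w : X → ℕ∞} (hvw : v ≤ w) {α : Ordinal.{u}} :
    ∀ {x : X}, OrderLE w α x → OrderLE v α x := by
  induction α using WellFoundedLT.induction with
  | _ α ih =>
    intro x h
    rw [orderLE_iff] at h ⊢
    obtain ⟨U, hU, n, h⟩ := h
    refine ⟨U, hU, n, fun y hy => (h y hy).imp ?_ (hvw y).trans⟩
    rintro ⟨γ, hγ, h⟩
    exact ⟨γ, hγ, ih γ hγ h⟩

/-- The order is a local notion: continuous open maps preserve and reflect it. -/
theorem orderLE_comp_iff {w : X → ℕ∞} {g : Y → X} (hg : Continuous g) (hg' : IsOpenMap g)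
    {α : Ordinal.{u}} : ∀ {y : Y}, OrderLE (w ∘ g) α y ↔ OrderLE w α (g y) := by
  induction α using WellFoundedLT.induction with
  | _ α ih =>
    intro y
    rw [orderLE_iff, orderLE_iff]
    constructor
    · rintro ⟨U, hU, n, h⟩
      refine ⟨g '' U, hg'.image_mem_nhds hU, n, ?_⟩
      rintro _ ⟨z, hz, rfl⟩
      refine (h z hz).imp_left ?_
      rintro ⟨γ, hγ, h⟩
      exact ⟨γ, hγ, (ih γ hγ).1 h⟩
    · rintro ⟨U, hU, n, h⟩
      refine ⟨g ⁻¹' U, hg.continuousAt hU, n, fun z hz => (h (g z) hz).imp_left ?_⟩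
      rintro ⟨γ, hγ, h⟩
      exact ⟨γ, hγ, (ih γ hγ).2 h⟩

theorem pointRank_comp {w : X → ℕ∞} {g : Y → X} (hg : Continuous g) (hg' : IsOpenMap g) (y : Y) :
    pointRank (w ∘ g) y = pointRank w (g y) := by
  simp only [pointRank, pointOrder, orderLE_comp_iff hg hg', Function.comp_apply]

theorem pointOrder_le {w : X → ℕ∞} {α : Ordinal.{u}} {x : X} (h : OrderLE w α x) :
    pointOrder w x ≤ α := sInf_le ⟨α, rfl, h⟩

theorem le_pointOrder {w : X → ℕ∞} {α : Ordinal.{u}} {x : X} (h : ∀ β < α, ¬ OrderLE w β x) :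
    (α : WithTop Ordinal.{u}) ≤ pointOrder w x := by
  refine le_sInf ?_
  rintro _ ⟨β, rfl, hβ⟩
  exact WithTop.coe_le_coe.2 (not_lt.1 fun hlt => h β hlt hβ)

theorem pointOrder_mono {v w : X → ℕ∞} (hvw : v ≤ w) (x : X) : pointOrder v x ≤ pointOrder w x := by
  refine sInf_le_sInf ?_
  rintro _ ⟨β, rfl, hβ⟩
  exact ⟨β, rfl, hβ.mono_left hvw⟩

theorem withTop_map_omega0_mul_mono :
    Monotone (WithTop.map (fun o : Ordinal.{u} => ω * o)) :=
  (WithTop.monotone_map_iff).2 fun _ _ h => mul_le_mul_right h ω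

theorem withTop_map_natCast_mono :
    Monotone (WithTop.map (fun n : ℕ => (n : Ordinal.{u})) : ℕ∞ → WithTop Ordinal.{u}) :=
  (WithTop.monotone_map_iff).2 fun _ _ h => Nat.cast_le.2 h

theorem pointRank_mono {v w : X → ℕ∞} (hvw : v ≤ w) (x : X) : pointRank v x ≤ pointRank w x :=
  add_le_add (withTop_map_omega0_mul_mono (pointOrder_mono hvw x))
    (withTop_map_natCast_mono (hvw x))

theorem weightRank_mono {v w : X → ℕ∞} (hvw : v ≤ w) : weightRank v ≤ weightRank w :=
  iSup_mono fun x => pointRank_mono hvw x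

theorem pointRank_le {w : X → ℕ∞} {α : Ordinal.{u}} {x : X} (h : OrderLE w α x) {n : ℕ}
    (hn : w x ≤ n) : pointRank w x ≤ ((ω * α + n : Ordinal.{u}) : WithTop Ordinal.{u}) := by
  rw [WithTop.coe_add]
  exact add_le_add (withTop_map_omega0_mul_mono (pointOrder_le h)) (withTop_map_natCast_mono hn)

theorem le_pointRank {w : X → ℕ∞} {α : Ordinal.{u}} {x : X} (h : ∀ β < α, ¬ OrderLE w β x) {n : ℕ}
    (hn : n ≤ w x) : ((ω * α + n : Ordinal.{u}) : WithTop Ordinal.{u}) ≤ pointRank w x := by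
  rw [WithTop.coe_add]
  exact add_le_add (withTop_map_omega0_mul_mono (le_pointOrder h)) (withTop_map_natCast_mono hn)

/-- A point of order less than `α` at which `w` is finite has rank at most `ω * α`, since
`ω * γ + n ≤ ω * (γ + 1)`. -/
theorem pointRank_le_of_lt {w : X → ℕ∞} {α γ : Ordinal.{u}} (hγ : γ < α) {x : X}
    (h : OrderLE w γ x) (hx : w x ≠ ⊤) (d : ℕ) :
    pointRank w x ≤ ((ω * α + d : Ordinal.{u}) : WithTop Ordinal.{u}) := by
  obtain ⟨n, hn⟩ := ENat.ne_top_iff_exists.1 hx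
  refine (pointRank_le h hn.ge).trans (WithTop.coe_le_coe.2 ?_)
  calc ω * γ + n ≤ ω * γ + ω := by gcongr; exact (natCast_lt_omega0 n).le
    _ = ω * (γ + 1) := by rw [mul_add_one]
    _ ≤ ω * α := by gcongr; exact Order.add_one_le_of_lt hγ
    _ ≤ ω * α + d := le_self_add

end Weight

/-! ### Irreducible representations and quotients -/

namespace IrrRep

variable {A C : Type u} [NonUnitalCStarAlgebra A] [NonUnitalCStarAlgebra C]

/-- The pullback of an irreducible representation along a surjective `*`-homomorphism. -/
noncomputable def comap (π : A →⋆ₙₐ[ℂ] C) (hπ : Function.Surjective π) (σ : IrrRep C) :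
    IrrRep A where
  space := σ.space
  toHom := σ.toHom.comp π
  ne_zero := by
    obtain ⟨c, hc⟩ := σ.ne_zero
    obtain ⟨a, rfl⟩ := hπ c
    exact ⟨a, hc⟩
  irreducible K hK h := σ.irreducible K hK fun c v hv => by
    obtain ⟨a, rfl⟩ := hπ c
    exact h a v hv

/-- An irreducible representation that vanishes on the kernel of a surjective `*`-homomorphism
factors through it. -/
theorem exists_eq_comap (π : A →⋆ₙₐ[ℂ] C) (hπ : Function.Surjective π) (ρ : IrrRep A)
    (h : ∀ a, π a = 0 → ρ.toHom a = 0) : ∃ σ : IrrRep C, ρ = σ.comap π hπ := by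
  have hwd (a b : A) (hab : π a = π b) : ρ.toHom a = ρ.toHom b := by
    rw [← sub_eq_zero, ← map_sub]
    exact h _ (by simp [hab])
  have hs (c : C) : π (Function.surjInv hπ c) = c := Function.surjInv_eq hπ c
  let f : C →⋆ₙₐ[ℂ] (ρ.space →L[ℂ] ρ.space) :=
    { toFun := fun c => ρ.toHom (Function.surjInv hπ c)
      map_smul' := fun z c => by
        rw [MonoidHom.id_apply, ← map_smul]
        exact hwd _ _ (by simp [hs])
      map_zero' := h _ (hs 0)
      map_add' := fun c c' => by
        rw [← map_add]
        exact hwd _ _ (by simp [hs])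
      map_mul' := fun c c' => by
        rw [← map_mul]
        exact hwd _ _ (by simp [hs])
      map_star' := fun c => by
        rw [← map_star]
        exact hwd _ _ (by rw [map_star, hs, hs]) }
  have hf (a : A) : f (π a) = ρ.toHom a := hwd _ _ (hs _)
  refine ⟨{ space := ρ.space
            toHom := f
            ne_zero := ?_
            irreducible := fun K hK hinv => ρ.irreducible K hK fun a v hv => ?_ }, ?_⟩
  · obtain ⟨a, ha⟩ := ρ.ne_zero
    exact ⟨π a, by rwa [hf]⟩
  · rw [← hf]
    exact hinv _ v hv
  · have : f.comp π = ρ.toHom := by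
      ext a : 1
      exact hf a
    unfold comap
    simp only [this]

theorem Equivalent.opRank_eq {ρ σ : IrrRep A} (h : ρ.Equivalent σ) (a : A) :
    ρ.opRank a = σ.opRank a := by
  obtain ⟨U, hU⟩ := h
  unfold opRank
  congr 1
  have : (LinearMap.range (ρ.toHom a : ρ.space →ₗ[ℂ] ρ.space)).map
      (U.toLinearEquiv : ρ.space →ₗ[ℂ] σ.space) =
      LinearMap.range (σ.toHom a : σ.space →ₗ[ℂ] σ.space) := by
    ext v
    constructor
    · rintro ⟨_, ⟨w, rfl⟩, rfl⟩
      exact ⟨U w, (hU a w).symm⟩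
    · rintro ⟨w, rfl⟩
      refine ⟨_, ⟨U.symm w, rfl⟩, ?_⟩
      refine (hU a (U.symm w)).trans ?_
      simp
  unfold LinearMap.rank
  rw [← this]
  exact (U.toLinearEquiv.submoduleMap _).rank_eq

theorem Equivalent.comap (π : A →⋆ₙₐ[ℂ] C) (hπ : Function.Surjective π) {ρ σ : IrrRep C}
    (h : ρ.Equivalent σ) : (ρ.comap π hπ).Equivalent (σ.comap π hπ) := by
  obtain ⟨U, hU⟩ := h
  exact ⟨U, fun a v => hU (π a) v⟩

theorem opRank_mul_le_left (ρ : IrrRep A) (a b : A) : ρ.opRank (a * b) ≤ ρ.opRank a := by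
  unfold opRank
  rw [map_mul]
  exact Cardinal.toENat.monotone' (LinearMap.rank_comp_le_left _ _)

theorem continuous (ρ : IrrRep A) : Continuous ρ.toHom :=
  AddMonoidHomClass.continuous_of_bound ρ.toHom 1 fun a => by
    rw [one_mul]
    exact NonUnitalStarAlgHom.norm_apply_le ρ.toHom a

theorem opRank_ne_top (ρ : IrrRep A) [FiniteDimensional ℂ ρ.space] (a : A) : ρ.opRank a ≠ ⊤ := by
  unfold opRank
  rw [Ne, Cardinal.toENat_eq_top, not_le]
  exact (LinearMap.rank_le_range _).trans_lt (Module.rank_lt_aleph0 ℂ ρ.space)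

end IrrRep

namespace IrrRep

variable {A : Type u} [CStarAlgebra A]

theorem map_one (ρ : IrrRep A) : ρ.toHom 1 = 1 := by
  have hK : IsClosed (LinearMap.ker ((1 - ρ.toHom 1 : ρ.space →L[ℂ] ρ.space) :
      ρ.space →ₗ[ℂ] ρ.space) : Set ρ.space) := (1 - ρ.toHom 1).isClosed_ker
  have hmem (v : ρ.space) : v ∈ LinearMap.ker ((1 - ρ.toHom 1 : ρ.space →L[ℂ] ρ.space) :
      ρ.space →ₗ[ℂ] ρ.space) ↔ ρ.toHom 1 v = v := by
    rw [LinearMap.mem_ker]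
    change v - ρ.toHom 1 v = 0 ↔ _
    rw [sub_eq_zero, eq_comm]
  have hmul (a : A) (v : ρ.space) : ρ.toHom 1 (ρ.toHom a v) = ρ.toHom a v := by
    have := DFunLike.congr_fun (map_mul ρ.toHom 1 a) v
    rw [one_mul] at this
    exact this.symm
  rcases ρ.irreducible _ hK fun a v _ => (hmem _).2 (hmul a v) with h | h
  · obtain ⟨a, ha⟩ := ρ.ne_zero
    refine (ha ?_).elim
    ext v
    have := (hmem _).2 (hmul a v)
    rw [h] at this
    simpa using this
  · ext v
    exact (hmem v).1 (h ▸ Submodule.mem_top)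

theorem nontrivial_space (ρ : IrrRep A) : Nontrivial ρ.space := by
  obtain ⟨a, ha⟩ := ρ.ne_zero
  by_contra hn
  rw [not_nontrivial_iff_subsingleton] at hn
  exact ha (by ext v; exact Subsingleton.elim _ _)

theorem one_notMem_ker (ρ : IrrRep A) : (1 : A) ∉ ρ.ker := by
  rw [mem_ker, map_one]
  have := ρ.nontrivial_space
  exact one_ne_zero

theorem opRank_one (ρ : IrrRep A) [FiniteDimensional ℂ ρ.space] :
    ρ.opRank 1 = Module.finrank ℂ ρ.space := by
  unfold opRank
  rw [map_one]
  have : ((1 : ρ.space →L[ℂ] ρ.space) : ρ.space →ₗ[ℂ] ρ.space) = LinearMap.id := rfl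
  rw [this, LinearMap.rank, LinearMap.range_id, rank_top, ← Module.finrank_eq_rank]
  simp

end IrrRep

/-! ### The primitive spectrum -/

namespace PrimSpectrum

variable {A C : Type u} [NonUnitalCStarAlgebra A] [NonUnitalCStarAlgebra C]

theorem isOpen_iff {U : Set (PrimSpectrum A)} :
    IsOpen U ↔ ∃ I : TwoSidedIdeal A, U = {t | ∃ x ∈ I, x ∉ t.1} := by
  have key (I : TwoSidedIdeal A) : {t : PrimSpectrum A | ∃ x ∈ I, x ∉ t.1} = (hull I)ᶜ := by
    ext t
    exact Set.not_subset.symm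
  constructor
  · rintro ⟨I, hI⟩
    exact ⟨I, by rw [key, ← hI, compl_compl]⟩
  · rintro ⟨I, rfl⟩
    rw [key]
    exact ⟨I, compl_compl _⟩

theorem exists_eq_toPrim (t : PrimSpectrum A) : ∃ ρ : IrrRep A, ρ.toPrim = t := by
  obtain ⟨ρ, hρ⟩ := t.2
  exact ⟨ρ, Subtype.ext hρ⟩

/-- The primitive ideals that do not contain `a` form an open set. -/
theorem isOpen_notMem (a : A) : IsOpen {t : PrimSpectrum A | a ∉ t.1} := by
  refine isOpen_iff.2 ⟨TwoSidedIdeal.span {a}, ?_⟩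
  ext t
  constructor
  · intro h
    exact ⟨a, TwoSidedIdeal.subset_span rfl, h⟩
  · rintro ⟨x, hx, hxt⟩ hat
    exact hxt (TwoSidedIdeal.span_le.2 (Set.singleton_subset_iff.2 hat) hx)

/-- The map of primitive spectra induced by a surjective `*`-homomorphism. -/
def comap (π : A →⋆ₙₐ[ℂ] C) (hπ : Function.Surjective π) (t : PrimSpectrum C) :
    PrimSpectrum A :=
  ⟨TwoSidedIdeal.comap π t.1, by
    obtain ⟨σ, hσ⟩ := t.2
    refine ⟨σ.comap π hπ, ?_⟩
    ext a
    rw [IrrRep.mem_ker, TwoSidedIdeal.mem_comap, ← hσ, IrrRep.mem_ker]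
    rfl⟩

variable (π : A →⋆ₙₐ[ℂ] C) (hπ : Function.Surjective π)

theorem mem_comap {t : PrimSpectrum C} {a : A} : a ∈ (comap π hπ t).1 ↔ π a ∈ t.1 :=
  TwoSidedIdeal.mem_comap _

theorem comap_toPrim (σ : IrrRep C) : comap π hπ σ.toPrim = (σ.comap π hπ).toPrim := by
  apply Subtype.ext
  ext a
  rw [mem_comap]
  change π a ∈ σ.ker ↔ a ∈ (σ.comap π hπ).ker
  rw [IrrRep.mem_ker, IrrRep.mem_ker]
  rfl

theorem continuous_comap : Continuous (comap π hπ) := by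
  refine continuous_def.2 fun U hU => ?_
  obtain ⟨I, rfl⟩ := isOpen_iff.1 hU
  refine isOpen_iff.2 ⟨TwoSidedIdeal.span (π '' I), ?_⟩
  ext t
  constructor
  · rintro ⟨x, hx, hxt⟩
    exact ⟨π x, TwoSidedIdeal.subset_span ⟨x, hx, rfl⟩, fun h => hxt ((mem_comap π hπ).2 h)⟩
  · rintro ⟨x, hx, hxt⟩
    by_contra hcon
    refine hxt (TwoSidedIdeal.span_le.2 ?_ hx)
    rintro _ ⟨y, hy, rfl⟩
    by_contra hyt
    exact hcon ⟨y, hy, fun h => hyt ((mem_comap π hπ).1 h)⟩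

end PrimSpectrum

/-! ### Ranks of elements -/

/-- Irreducible representations with the same kernel are equivalent, i.e. the spectrum is a
`T₀`-space. This makes the value of a Pedersen function at a primitive ideal computable from any
representation with that kernel. -/
def HasT0Spectrum (A : Type u) [NonUnitalCStarAlgebra A] : Prop :=
  ∀ ρ σ : IrrRep A, ρ.ker = σ.ker → ρ.Equivalent σ

section Ranks

variable {A C : Type u} [NonUnitalCStarAlgebra A] [NonUnitalCStarAlgebra C]

theorem pedersenFun_toPrim (hA : HasT0Spectrum A) (ρ : IrrRep A) (a : A) :
    pedersenFun a ρ.toPrim = ρ.opRank a :=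
  (hA _ _ ρ.toPrim.2.choose_spec).opRank_eq a

theorem pedersenFun_comap (hA : HasT0Spectrum A) (hC : HasT0Spectrum C) (π : A →⋆ₙₐ[ℂ] C)
    (hπ : Function.Surjective π) (a : A) (t : PrimSpectrum C) :
    pedersenFun a (PrimSpectrum.comap π hπ t) = pedersenFun (π a) t := by
  obtain ⟨σ, rfl⟩ := t.exists_eq_toPrim
  rw [PrimSpectrum.comap_toPrim, pedersenFun_toPrim hA, pedersenFun_toPrim hC]
  rfl

theorem pedersenFun_ne_top (hA : IsPreliminary A) (a : A) (t : PrimSpectrum A) :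
    pedersenFun a t ≠ ⊤ := by
  have := hA t.2.choose
  exact IrrRep.opRank_ne_top _ a

theorem sectionFellRank_eq (b : A) {U : Set (PrimSpectrum A)} (hU : IsOpen U) :
    sectionFellRank b U = ⨆ t : U, pointRank (pedersenFun b) t.1 := by
  unfold sectionFellRank weightRank
  exact iSup_congr fun t =>
    pointRank_comp (w := pedersenFun b) continuous_subtype_val hU.isOpenMap_subtype_val t

theorem sectionFellRank_le (b : A) {U : Set (PrimSpectrum A)} (hU : IsOpen U) :
    sectionFellRank b U ≤ elementPedersenRank b := by
  rw [sectionFellRank_eq b hU]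
  exact iSup_le fun t => le_iSup (pointRank (pedersenFun b)) t.1

theorem IsLocalSection.fellRank_le {ρ : IrrRep A} {b : A} {U : Set (PrimSpectrum A)}
    (h : IsLocalSection ρ b U) : ρ.fellRank ≤ sectionFellRank b U := by
  unfold IrrRep.fellRank
  exact sInf_le ⟨b, U, h, rfl⟩

theorem IrrRep.fellRank_le {ρ : IrrRep A} {b : A} (hb : ρ.toHom b ≠ 0) :
    ρ.fellRank ≤ elementPedersenRank b := by
  have hsec : IsLocalSection ρ b {t | b ∉ t.1} :=
    ⟨PrimSpectrum.isOpen_notMem b, fun h => hb ((ρ.mem_ker b).1 h),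
      fun σ hσ h => hσ ((σ.mem_ker b).2 h)⟩
  exact hsec.fellRank_le.trans (sectionFellRank_le b hsec.1)

theorem IrrRep.fellRank_le_pedersenRank (ρ : IrrRep A) : ρ.fellRank ≤ pedersenRank A := by
  obtain ⟨a, ha⟩ := ρ.ne_zero
  exact (ρ.fellRank_le ha).trans (le_iSup elementPedersenRank a)

/-- If some irreducible representation has Fell rank larger than `α`, it vanishes on the Fell ideal
of rank `α`. -/
theorem fellIdeal_ne_univ {ρ : IrrRep A} {α : Ordinal.{u}} (h : α < ρ.fellRank) :
    fellIdeal A α ≠ Set.univ := by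
  intro huniv
  obtain ⟨a, ha⟩ := ρ.ne_zero
  have hcl : IsClosed {x : A | ρ.toHom x = 0} :=
    isClosed_eq ρ.continuous continuous_const
  have hsub : (TwoSidedIdeal.span {a : A | elementPedersenRank a ≤ α} : Set A) ⊆
      {x : A | ρ.toHom x = 0} := by
    intro x hx
    refine (ρ.mem_ker x).1 (TwoSidedIdeal.span_le.2 ?_ hx)
    intro b hb
    refine (ρ.mem_ker b).2 ?_
    by_contra hne
    exact absurd (h.trans_le ((ρ.fellRank_le hne).trans hb)) (lt_irrefl _)
  have : a ∈ fellIdeal A α := huniv ▸ Set.mem_univ a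
  exact ha (closure_minimal hsub hcl this)

theorem isTypeI_of_pedersenRank_le {α : Ordinal.{u}} (h : pedersenRank A ≤ (1 + α : Ordinal.{u})) :
    IsTypeI A α := by
  refine Set.eq_univ_of_forall fun a => subset_closure (TwoSidedIdeal.subset_span ?_)
  exact (le_iSup elementPedersenRank a).trans h

end Ranks

section UnitalRanks

variable {A : Type u} [CStarAlgebra A]

theorem pedersenFun_le_one (a : A) : pedersenFun a ≤ pedersenFun 1 := by
  intro t
  have := t.2.choose.opRank_mul_le_left 1 a
  rwa [one_mul] at this

theorem pedersenFun_eq_one_of_isUnit {a : A} (ha : IsUnit a) :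
    pedersenFun a = pedersenFun 1 := by
  obtain ⟨b, hb⟩ := ha.exists_right_inv
  refine le_antisymm (pedersenFun_le_one a) fun t => ?_
  have := t.2.choose.opRank_mul_le_left a b
  rwa [hb] at this

/-- In a unital algebra the unit has the largest Pedersen rank. -/
theorem pedersenRank_eq_one : pedersenRank A = elementPedersenRank (1 : A) :=
  le_antisymm (iSup_le fun a => weightRank_mono (pedersenFun_le_one a))
    (le_iSup elementPedersenRank (1 : A))

end UnitalRanks

/-! ### Algebras glued from ideals and boundary quotients -/

/-- A C*-algebra `A` contains the algebras `C i` as orthogonal ideals, which are at the same time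
quotients of `A` by the maps `coord i`; the quotient by the closure of their sum embeds into the
product of the quotients `Q j` of `A`. The last condition says that the primitive ideals of `C i`
converge to each primitive ideal that comes from a `Q j`. -/
structure BoundaryDecomposition (A : Type u) [NonUnitalCStarAlgebra A] {ι κ : Type}
    (C : ι → Type u) [∀ i, CStarAlgebra (C i)] (Q : κ → Type u) [∀ j, CStarAlgebra (Q j)] where
  /-- The quotient maps onto the summands. -/
  coord : ∀ i, A →⋆ₙₐ[ℂ] C i
  /-- The quotient maps onto the boundary algebras. -/
  bdry : ∀ j, A →⋆ₙₐ[ℂ] Q j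
  bdry_surjective : ∀ j, Function.Surjective (bdry j)
  exists_lift : ∀ i c, ∃ x, coord i x = c ∧ (∀ i', i' ≠ i → coord i' x = 0) ∧ ∀ j, bdry j x = 0
  eq_zero : ∀ x, (∀ i, coord i x = 0) → (∀ j, bdry j x = 0) → x = 0
  mem_closure : ∀ x, (∀ j, bdry j x = 0) →
    x ∈ closure {y | (∀ j, bdry j y = 0) ∧ {i | coord i y ≠ 0}.Finite}
  eventually_full : ∀ j x, bdry j x ≠ 0 →
    ∀ᶠ i in cofinite, ∀ K : TwoSidedIdeal (C i), coord i x ∈ K → (1 : C i) ∈ K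

namespace IrrRep

variable {A : Type u} [NonUnitalCStarAlgebra A]

/-- The kernel of an irreducible representation is prime, also for finite families of ideals. -/
theorem exists_ker_le_of_iInf_le (ρ : IrrRep A) {κ : Type} [Finite κ] (I : κ → TwoSidedIdeal A)
    (h : ∀ x, (∀ j, x ∈ I j) → x ∈ ρ.ker) : ∃ j, I j ≤ ρ.ker := by
  classical
  have := Fintype.ofFinite κ
  have key (s : Finset κ) :
      ∀ J : TwoSidedIdeal A, (∀ x, x ∈ J → (∀ j ∈ s, x ∈ I j) → x ∈ ρ.ker) →
      J ≤ ρ.ker ∨ ∃ j ∈ s, I j ≤ ρ.ker := by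
    induction s using Finset.induction_on with
    | empty => exact fun J hJ => Or.inl fun x hx => hJ x hx (by simp)
    | insert a s _ ih =>
      intro J hJ
      rcases ih (J ⊓ I a) (fun x hx hxs => by
        rw [TwoSidedIdeal.mem_inf] at hx
        refine hJ x hx.1 fun j hj => ?_
        rcases Finset.mem_insert.1 hj with rfl | hj
        · exact hx.2
        · exact hxs j hj) with h | ⟨j, hj, h⟩
      · exact (ρ.ker_prime h).imp_right fun h => ⟨a, Finset.mem_insert_self _ _, h⟩
      · exact Or.inr ⟨j, Finset.mem_insert_of_mem hj, h⟩
  rcases key Finset.univ ⊤ (fun x _ hx => h x fun j => hx j (Finset.mem_univ j)) with h | ⟨j, _, h⟩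
  · obtain ⟨a, ha⟩ := ρ.ne_zero
    exact (ha ((ρ.mem_ker a).1 (h (TwoSidedIdeal.mem_top A)))).elim
  · exact ⟨j, h⟩

end IrrRep

namespace BoundaryDecomposition

variable {A : Type u} [NonUnitalCStarAlgebra A] {ι κ : Type}
  {C : ι → Type u} [∀ i, CStarAlgebra (C i)] {Q : κ → Type u} [∀ j, CStarAlgebra (Q j)]
  (D : BoundaryDecomposition A C Q)

include D

theorem coord_surjective (i : ι) : Function.Surjective (D.coord i) := fun c =>
  let ⟨x, hx, _⟩ := D.exists_lift i c
  ⟨x, hx⟩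

/-- An irreducible representation that does not vanish on the ideal `C i` factors through the
quotient `C i`. -/
theorem eq_zero_of_coord_eq_zero (ρ : IrrRep A) {i : ι} {y : A}
    (hy : ∀ i', i' ≠ i → D.coord i' y = 0)
    (hy' : ∀ j, D.bdry j y = 0) (hρ : ρ.toHom y ≠ 0) (x : A) (hx : D.coord i x = 0) :
    ρ.toHom x = 0 := by
  let J : TwoSidedIdeal A := (⨅ i' : {i' // i' ≠ i}, TwoSidedIdeal.ker (D.coord i'.1)) ⊓
    ⨅ j, TwoSidedIdeal.ker (D.bdry j)
  have hJ (z : A) : z ∈ J ↔ (∀ i', i' ≠ i → D.coord i' z = 0) ∧ ∀ j, D.bdry j z = 0 := by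
    simp only [J, TwoSidedIdeal.mem_inf, TwoSidedIdeal.mem_iInf, TwoSidedIdeal.mem_ker,
      Subtype.forall]
  have hle : TwoSidedIdeal.ker (D.coord i) ⊓ J ≤ ρ.ker := by
    intro z hz
    rw [TwoSidedIdeal.mem_inf, hJ, TwoSidedIdeal.mem_ker] at hz
    have : z = 0 := D.eq_zero z (fun i' => by
      by_cases h : i' = i
      · exact h ▸ hz.1
      · exact hz.2.1 i' h) hz.2.2
    rw [this]
    exact ρ.ker.zero_mem
  rcases ρ.ker_prime hle with h | h
  · exact (ρ.mem_ker x).1 (h ((TwoSidedIdeal.mem_ker _).2 hx))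
  · exact (hρ ((ρ.mem_ker y).1 (h ((hJ y).2 ⟨hy, hy'⟩)))).elim

/-- Every irreducible representation factors through one of the quotients. -/
theorem exists_factor [Finite κ] (ρ : IrrRep A) :
    (∃ i, ∀ x, D.coord i x = 0 → ρ.toHom x = 0) ∨
      ∃ j, ∀ x, D.bdry j x = 0 → ρ.toHom x = 0 := by
  classical
  by_cases h : ∃ i y, (∀ i', i' ≠ i → D.coord i' y = 0) ∧ (∀ j, D.bdry j y = 0) ∧ ρ.toHom y ≠ 0
  · obtain ⟨i, y, h1, h2, h3⟩ := h
    exact Or.inl ⟨i, D.eq_zero_of_coord_eq_zero ρ h1 h2 h3⟩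
  push Not at h
  -- `ρ` vanishes on finitely supported elements, hence on the closure of the sum of the ideals
  have hfin (y : A) (hy : ∀ j, D.bdry j y = 0) (hs : {i | D.coord i y ≠ 0}.Finite) :
      ρ.toHom y = 0 := by
    choose l hl hl' hl'' using fun i => D.exists_lift i (D.coord i y)
    have : y = ∑ i ∈ hs.toFinset, l i := by
      rw [← sub_eq_zero]
      refine D.eq_zero _ (fun i => ?_) fun j => ?_
      · rw [map_sub, map_sum, sub_eq_zero]
        by_cases hi : i ∈ hs.toFinset
        · rw [Finset.sum_eq_single_of_mem i hi fun i' _ hne => hl' i' i hne.symm, hl]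
        · rw [Finset.sum_eq_zero fun i' hi' => hl' i' i fun heq => hi (heq ▸ hi')]
          simpa using hi
      · rw [map_sub, map_sum, hy, Finset.sum_eq_zero fun i' _ => hl'' i' j]
        exact sub_zero _
    rw [this, map_sum]
    exact Finset.sum_eq_zero fun i _ => h i (l i) (hl' i) (hl'' i)
  obtain ⟨j, hj⟩ := ρ.exists_ker_le_of_iInf_le (fun j => TwoSidedIdeal.ker (D.bdry j)) (by
    intro x hx
    refine (ρ.mem_ker x).2 ?_
    have hcl : IsClosed {x : A | ρ.toHom x = 0} := isClosed_eq ρ.continuous continuous_const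
    refine closure_minimal ?_ hcl (D.mem_closure x fun j => (TwoSidedIdeal.mem_ker _).1 (hx j))
    exact fun y hy => hfin y hy.1 hy.2)
  exact Or.inr ⟨j, fun x hx => (ρ.mem_ker x).1 (hj ((TwoSidedIdeal.mem_ker _).2 hx))⟩

theorem exists_eq_comap [Finite κ] (ρ : IrrRep A) :
    (∃ i σ, ρ = IrrRep.comap (D.coord i) (D.coord_surjective i) σ) ∨
      ∃ j σ, ρ = IrrRep.comap (D.bdry j) (D.bdry_surjective j) σ :=
  (D.exists_factor ρ).imp (fun ⟨i, h⟩ => ⟨i, ρ.exists_eq_comap _ _ h⟩)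
    fun ⟨j, h⟩ => ⟨j, ρ.exists_eq_comap _ _ h⟩

theorem isPreliminary [Finite κ] (hC : ∀ i, IsPreliminary (C i)) (hQ : ∀ j, IsPreliminary (Q j)) :
    IsPreliminary A := by
  intro ρ
  rcases D.exists_eq_comap ρ with ⟨i, σ, rfl⟩ | ⟨j, σ, rfl⟩
  · exact hC i σ
  · exact hQ j σ

theorem isScattered [Finite κ] [Countable ι] (hC : ∀ i, IsScattered (C i))
    (hQ : ∀ j, IsScattered (Q j)) : IsScattered A := by
  have (i : ι) : Countable (CStarSpectrum (C i)) := hC i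
  have (j : κ) : Countable (CStarSpectrum (Q j)) := hQ j
  let f : (Σ i, CStarSpectrum (C i)) ⊕ (Σ j, CStarSpectrum (Q j)) → CStarSpectrum A :=
    Sum.elim
      (fun p => Quotient.map' (IrrRep.comap (D.coord p.1) (D.coord_surjective p.1))
        (fun _ _ h => IrrRep.Equivalent.comap _ _ h) p.2)
      (fun p => Quotient.map' (IrrRep.comap (D.bdry p.1) (D.bdry_surjective p.1))
        (fun _ _ h => IrrRep.Equivalent.comap _ _ h) p.2)
  refine Function.Surjective.countable (f := f) fun t => ?_
  induction t using Quotient.inductionOn with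
  | _ ρ =>
    rcases D.exists_eq_comap ρ with ⟨i, σ, rfl⟩ | ⟨j, σ, rfl⟩
    · exact ⟨Sum.inl ⟨i, Quotient.mk _ σ⟩, rfl⟩
    · exact ⟨Sum.inr ⟨j, Quotient.mk _ σ⟩, rfl⟩

omit D in
theorem _root_.IrrRep.equivalent_of_factor {A C : Type u} [NonUnitalCStarAlgebra A]
    [NonUnitalCStarAlgebra C] (hC : HasT0Spectrum C) (π : A →⋆ₙₐ[ℂ] C)
    (hπ : Function.Surjective π) {ρ σ : IrrRep A} (h : ρ.ker = σ.ker)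
    (hρ : ∀ x, π x = 0 → ρ.toHom x = 0) : ρ.Equivalent σ := by
  have hker (x : A) : ρ.toHom x = 0 ↔ σ.toHom x = 0 := by
    rw [← IrrRep.mem_ker, h, IrrRep.mem_ker]
  obtain ⟨σ', rfl⟩ := σ.exists_eq_comap π hπ fun x hx => (hker x).1 (hρ x hx)
  obtain ⟨ρ', rfl⟩ := ρ.exists_eq_comap π hπ hρ
  refine (hC ρ' σ' ?_).comap π hπ
  ext c
  obtain ⟨x, rfl⟩ := hπ c
  rw [IrrRep.mem_ker, IrrRep.mem_ker]
  exact hker x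

theorem hasT0Spectrum [Finite κ] (hC : ∀ i, HasT0Spectrum (C i)) (hQ : ∀ j, HasT0Spectrum (Q j)) :
    HasT0Spectrum A := by
  intro ρ σ h
  rcases D.exists_factor ρ with ⟨i, hi⟩ | ⟨j, hj⟩
  · exact IrrRep.equivalent_of_factor (hC i) _ (D.coord_surjective i) h hi
  · exact IrrRep.equivalent_of_factor (hQ j) _ (D.bdry_surjective j) h hj

/-- The inclusion of the primitive spectrum of `C i` into that of `A`. -/
noncomputable def incl (i : ι) : PrimSpectrum (C i) → PrimSpectrum A :=
  PrimSpectrum.comap (D.coord i) (D.coord_surjective i)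

theorem continuous_incl (i : ι) : Continuous (D.incl i) := PrimSpectrum.continuous_comap _ _

theorem isOpenMap_incl (i : ι) : IsOpenMap (D.incl i) := by
  intro U hU
  obtain ⟨I, rfl⟩ := PrimSpectrum.isOpen_iff.1 hU
  let J : TwoSidedIdeal A := (⨅ i' : {i' // i' ≠ i}, TwoSidedIdeal.ker (D.coord i'.1)) ⊓
    (⨅ j, TwoSidedIdeal.ker (D.bdry j)) ⊓ TwoSidedIdeal.comap (D.coord i) I
  have hJ (z : A) : z ∈ J ↔
      ((∀ i', i' ≠ i → D.coord i' z = 0) ∧ ∀ j, D.bdry j z = 0) ∧ D.coord i z ∈ I := by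
    simp only [J, TwoSidedIdeal.mem_inf, TwoSidedIdeal.mem_iInf, TwoSidedIdeal.mem_ker,
      Subtype.forall, TwoSidedIdeal.mem_comap]
  refine PrimSpectrum.isOpen_iff.2 ⟨J, ?_⟩
  ext t
  constructor
  · rintro ⟨s, ⟨c, hc, hcs⟩, rfl⟩
    obtain ⟨x, rfl, hx, hx'⟩ := D.exists_lift i c
    exact ⟨x, (hJ x).2 ⟨⟨hx, hx'⟩, hc⟩, fun h => hcs ((PrimSpectrum.mem_comap _ _).1 h)⟩
  · rintro ⟨x, hx, hxt⟩
    obtain ⟨ρ, rfl⟩ := t.exists_eq_toPrim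
    obtain ⟨⟨hx1, hx2⟩, hx3⟩ := (hJ x).1 hx
    have hρ : ρ.toHom x ≠ 0 := fun h => hxt ((ρ.mem_ker x).2 h)
    obtain ⟨σ, rfl⟩ := ρ.exists_eq_comap (D.coord i) (D.coord_surjective i)
      (D.eq_zero_of_coord_eq_zero ρ hx1 hx2 hρ)
    refine ⟨σ.toPrim, ⟨D.coord i x, hx3, ?_⟩, PrimSpectrum.comap_toPrim _ _ _⟩
    exact fun h => hρ ((σ.mem_ker _).1 h)

theorem exists_eq_incl [Finite κ] (t : PrimSpectrum A) : (∃ i s, t = D.incl i s) ∨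
    ∃ j s, t = PrimSpectrum.comap (D.bdry j) (D.bdry_surjective j) s := by
  obtain ⟨ρ, rfl⟩ := t.exists_eq_toPrim
  rcases D.exists_eq_comap ρ with ⟨i, σ, rfl⟩ | ⟨j, σ, rfl⟩
  · exact Or.inl ⟨i, σ.toPrim, (PrimSpectrum.comap_toPrim _ _ _).symm⟩
  · exact Or.inr ⟨j, σ.toPrim, (PrimSpectrum.comap_toPrim _ _ _).symm⟩

/-- A neighbourhood of a boundary point contains the primitive spectra of almost all `C i`. -/
theorem eventually_incl_mem {j : κ} {s : PrimSpectrum (Q j)} {U : Set (PrimSpectrum A)}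
    (hU : U ∈ 𝓝 (PrimSpectrum.comap (D.bdry j) (D.bdry_surjective j) s)) :
    ∀ᶠ i in cofinite, ∀ t, D.incl i t ∈ U := by
  obtain ⟨V, hVU, hV, hs⟩ := mem_nhds_iff.1 hU
  obtain ⟨I, rfl⟩ := PrimSpectrum.isOpen_iff.1 hV
  obtain ⟨x, hxI, hx⟩ := hs
  have hne : D.bdry j x ≠ 0 := fun h =>
    hx ((PrimSpectrum.mem_comap _ _).2 (by rw [h]; exact s.1.zero_mem))
  refine (D.eventually_full j x hne).mono fun i hi t => hVU ⟨x, hxI, fun h => ?_⟩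
  obtain ⟨σ, rfl⟩ := t.exists_eq_toPrim
  exact σ.one_notMem_ker (hi _ ((PrimSpectrum.mem_comap _ _).1 h))

theorem pointRank_incl (hA : HasT0Spectrum A) (hC : ∀ i, HasT0Spectrum (C i)) (a : A) (i : ι)
    (t : PrimSpectrum (C i)) : pointRank (pedersenFun a) (D.incl i t) =
      pointRank (pedersenFun (D.coord i a)) t := by
  rw [← pointRank_comp (D.continuous_incl i) (D.isOpenMap_incl i)]
  congr 1
  ext s : 1
  exact pedersenFun_comap hA (hC i) _ _ a s

theorem orderLE_incl (hA : HasT0Spectrum A) (hC : ∀ i, HasT0Spectrum (C i)) (a : A) (i : ι)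
    (t : PrimSpectrum (C i)) {α : Ordinal.{u}} : OrderLE (pedersenFun a) α (D.incl i t) ↔
      OrderLE (pedersenFun (D.coord i a)) α t := by
  rw [← orderLE_comp_iff (D.continuous_incl i) (D.isOpenMap_incl i)]
  have : pedersenFun a ∘ D.incl i = pedersenFun (D.coord i a) :=
    funext fun s => pedersenFun_comap hA (hC i) _ _ a s
  rw [this]

/-- An irreducible representation of an ideal `C i` has at least the same Fell rank in `A`. -/
theorem fellRank_le_comap (hA : HasT0Spectrum A) (hC : ∀ i, HasT0Spectrum (C i)) (i : ι)
    (σ : IrrRep (C i)) :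
    σ.fellRank ≤ (IrrRep.comap (D.coord i) (D.coord_surjective i) σ).fellRank := by
  refine le_sInf ?_
  rintro _ ⟨b, U, ⟨hU, hσU, hb⟩, rfl⟩
  have hU' : IsOpen (D.incl i ⁻¹' U) := hU.preimage (D.continuous_incl i)
  have hsec : IsLocalSection σ (D.coord i b) (D.incl i ⁻¹' U) := by
    refine ⟨hU', ?_, fun τ hτ => ?_⟩
    · rw [Set.mem_preimage, incl, PrimSpectrum.comap_toPrim]
      exact hσU
    · refine hb (IrrRep.comap (D.coord i) (D.coord_surjective i) τ) ?_
      rw [← PrimSpectrum.comap_toPrim]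
      exact hτ
  refine hsec.fellRank_le.trans ?_
  rw [sectionFellRank_eq _ hU', sectionFellRank_eq _ hU]
  refine iSup_le fun t => ?_
  rw [← D.pointRank_incl hA hC b i t.1]
  exact le_iSup (fun s : U => pointRank (pedersenFun b) s.1) ⟨D.incl i t.1, t.2⟩

end BoundaryDecomposition

/-! ### Matrix units and the irreducible representations of matrix algebras -/

namespace MatAlg

section Units

variable {n : ℕ} {A : Type u} [CStarAlgebra A]

theorem ext_entry {x y : MatAlg n A} (h : ∀ i j, x.entry i j = y.entry i j) : x = y :=
  CStarMatrix.ext (A := A) h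

/-- The matrix with `(i, j)` entry `a` and zeros elsewhere. -/
def single (i j : Fin n) (a : A) : MatAlg n A := Matrix.single i j a

/-- The matrix with prescribed entries. -/
def of (f : Fin n → Fin n → A) : MatAlg n A := f

@[simp] theorem entry_of (f : Fin n → Fin n → A) (i j : Fin n) : (of f).entry i j = f i j := rfl

@[simp] theorem entry_zero (i j : Fin n) : (0 : MatAlg n A).entry i j = 0 := rfl

theorem entry_mul (x y : MatAlg n A) (i j : Fin n) :
    (x * y).entry i j = ∑ k, x.entry i k * y.entry k j := rfl

theorem single_mul_single (i j k : Fin n) (a b : A) :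
    single i j a * single j k b = single i k (a * b) :=
  Matrix.single_mul_single_same (c := a) i j k b

theorem single_mul_single_of_ne {j k : Fin n} (h : j ≠ k) (i l : Fin n) (a b : A) :
    single i j a * single k l b = 0 :=
  Matrix.single_mul_single_of_ne (c := a) i j k h b

theorem star_single (i j : Fin n) (a : A) : star (single i j a) = single j i (star a) :=
  Matrix.conjTranspose_single i j a

theorem single_mul_mul_single (i j k l : Fin n) (a b : A) (x : MatAlg n A) :
    single i j a * x * single k l b = single i l (a * x.entry j k * b) :=
  Matrix.single_mul_mul_single i j k l a x b

theorem eq_sum_single (x : MatAlg n A) : x = ∑ i, ∑ j, single i j (x.entry i j) :=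
  Matrix.matrix_eq_sum_single (show Matrix (Fin n) (Fin n) A from x)

theorem one_eq_sum_single : (1 : MatAlg n A) = ∑ i, single i i 1 :=
  (Matrix.sum_single_one (m := Fin n) (α := A)).symm

end Units

section Complex

variable {d : ℕ}

theorem smul_single_one (i j : Fin d) (c : ℂ) : single i j c = c • single i j (1 : ℂ) := by
  have := Matrix.smul_single c i j (1 : ℂ)
  rw [_root_.smul_eq_mul, mul_one] at this
  exact this.symm

/-- Every irreducible representation of `M_d(ℂ)` is the standard one in a suitable orthonormal
basis. -/
theorem exists_orthonormalBasis (ρ : IrrRep (MatAlg d ℂ)) :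
    ∃ v : OrthonormalBasis (Fin d) ℂ ρ.space, ∀ i j k,
      ρ.toHom (single i j 1) (v k) = if j = k then v i else 0 := by
  have hone : ∑ i, ρ.toHom (single i i 1) = 1 := by
    rw [← map_sum, ← one_eq_sum_single, ρ.map_one]
  have hnt := ρ.nontrivial_space
  obtain ⟨k, hk⟩ : ∃ k, ρ.toHom (single k k 1) ≠ 0 := by
    by_contra! hcon
    rw [Finset.sum_eq_zero fun i _ => hcon i] at hone
    exact zero_ne_one hone
  have hmul (a b : MatAlg d ℂ) (w : ρ.space) : ρ.toHom a (ρ.toHom b w) = ρ.toHom (a * b) w := by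
    rw [map_mul]
    rfl
  obtain ⟨ξ, hξ1, hξ⟩ : ∃ ξ : ρ.space, ‖ξ‖ = 1 ∧ ρ.toHom (single k k 1) ξ = ξ := by
    obtain ⟨w, hw⟩ : ∃ w, ρ.toHom (single k k 1) w ≠ 0 := by
      by_contra! hcon
      exact hk (by ext w; exact hcon w)
    refine ⟨((‖ρ.toHom (single k k 1) w‖ : ℂ)⁻¹) • ρ.toHom (single k k 1) w, ?_, ?_⟩
    · exact norm_smul_inv_norm hw
    · rw [map_smul, hmul, single_mul_single, one_mul]
  let v (i : Fin d) : ρ.space := ρ.toHom (single i k 1) ξ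
  have hv (i j l : Fin d) : ρ.toHom (single i j 1) (v l) = if j = l then v i else 0 := by
    split_ifs with h
    · subst h
      change ρ.toHom _ (ρ.toHom _ ξ) = _
      rw [hmul, single_mul_single, one_mul]
    · change ρ.toHom _ (ρ.toHom _ ξ) = _
      rw [hmul, single_mul_single_of_ne h, map_zero]
      rfl
  have hon : Orthonormal ℂ v := by
    rw [orthonormal_iff_ite]
    intro i j
    have h1 : inner ℂ (v i) (v j) = inner ℂ ξ (ρ.toHom (single k i 1) (v j)) := by
      have : ρ.toHom (single k i 1) = ContinuousLinearMap.adjoint (ρ.toHom (single i k 1)) := by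
        rw [← ContinuousLinearMap.star_eq_adjoint, ← map_star, star_single, star_one]
      rw [this, ContinuousLinearMap.adjoint_inner_right]
    rw [h1, hv]
    split_ifs with h
    · change inner ℂ ξ (ρ.toHom (single k k 1) ξ) = _
      rw [hξ, inner_self_eq_norm_sq_to_K, hξ1]
      simp
    · exact inner_zero_right _
  have hspan : Submodule.span ℂ (Set.range v) = ⊤ := by
    have : FiniteDimensional ℂ (Submodule.span ℂ (Set.range v)) :=
      FiniteDimensional.span_of_finite ℂ (Set.finite_range v)
    have hinv (a : MatAlg d ℂ) :
        ∀ w ∈ Submodule.span ℂ (Set.range v), ρ.toHom a w ∈ Submodule.span ℂ (Set.range v) := by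
      intro w hw
      rw [eq_sum_single a, map_sum, _root_.sum_apply]
      refine Submodule.sum_mem _ fun i _ => ?_
      rw [map_sum, _root_.sum_apply]
      refine Submodule.sum_mem _ fun j _ => ?_
      rw [smul_single_one, map_smul]
      refine Submodule.smul_mem _ _ ?_
      induction hw using Submodule.span_induction with
      | mem x hx =>
        obtain ⟨l, rfl⟩ := hx
        refine (congrArg (· ∈ Submodule.span ℂ (Set.range v)) (hv i j l)).mpr ?_
        split_ifs
        · exact Submodule.subset_span ⟨i, rfl⟩
        · exact Submodule.zero_mem _
      | zero => rw [map_zero]; exact Submodule.zero_mem _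
      | add x y _ _ hx hy => rw [map_add]; exact Submodule.add_mem _ hx hy
      | smul c x _ hx => rw [map_smul]; exact Submodule.smul_mem _ _ hx
    refine (ρ.irreducible _ (Submodule.closed_of_finiteDimensional _) hinv).resolve_left ?_
    intro hbot
    have : v k ∈ Submodule.span ℂ (Set.range v) := Submodule.subset_span ⟨k, rfl⟩
    rw [hbot, Submodule.mem_bot] at this
    exact hon.ne_zero k this
  refine ⟨OrthonormalBasis.mk hon hspan.ge, fun i j l => ?_⟩
  rw [OrthonormalBasis.coe_mk]
  exact hv i j l

theorem equivalent_of_complex (ρ σ : IrrRep (MatAlg d ℂ)) : ρ.Equivalent σ := by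
  obtain ⟨v, hv⟩ := exists_orthonormalBasis ρ
  obtain ⟨w, hw⟩ := exists_orthonormalBasis σ
  let U : ρ.space ≃ₗᵢ[ℂ] σ.space := v.repr.trans w.repr.symm
  have hU (i : Fin d) : U (v i) = w i := by simp [U]
  refine ⟨U, fun a x => ?_⟩
  have key (i j : Fin d) : (U.toLinearEquiv : ρ.space →ₗ[ℂ] σ.space) ∘ₗ
      (ρ.toHom (single i j 1) : ρ.space →ₗ[ℂ] ρ.space) =
      (σ.toHom (single i j 1) : σ.space →ₗ[ℂ] σ.space) ∘ₗ
        (U.toLinearEquiv : ρ.space →ₗ[ℂ] σ.space) := by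
    refine v.toBasis.ext fun k => ?_
    rw [v.coe_toBasis]
    change U (ρ.toHom (single i j 1) (v k)) = σ.toHom (single i j 1) (U (v k))
    rw [hv, hU, hw]
    split_ifs
    · exact hU i
    · exact map_zero U
  rw [eq_sum_single a]
  simp only [map_sum, _root_.sum_apply]
  refine Finset.sum_congr rfl fun i _ => Finset.sum_congr rfl fun j _ => ?_
  rw [smul_single_one, map_smul, map_smul]
  refine (map_smul U (a.entry i j) (ρ.toHom (single i j 1) x)).trans ?_
  exact congrArg (a.entry i j • ·) (LinearMap.congr_fun (key i j) x)

theorem hasT0Spectrum_complex : HasT0Spectrum (MatAlg d ℂ) :=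
  fun ρ σ _ => equivalent_of_complex ρ σ

theorem isScattered_complex : IsScattered (MatAlg d ℂ) := by
  have : Subsingleton (CStarSpectrum (MatAlg d ℂ)) := by
    refine ⟨fun s t => ?_⟩
    induction s using Quotient.inductionOn with
    | _ ρ =>
      induction t using Quotient.inductionOn with
      | _ σ => exact Quotient.sound (equivalent_of_complex ρ σ)
  exact Finite.to_countable

theorem isPreliminary_complex : IsPreliminary (MatAlg d ℂ) := fun ρ => by
  obtain ⟨v, _⟩ := exists_orthonormalBasis ρ
  exact v.toBasis.finiteDimensional_of_finite

theorem pedersenFun_one_complex (t : PrimSpectrum (MatAlg d ℂ)) :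
    pedersenFun (1 : MatAlg d ℂ) t = d := by
  obtain ⟨ρ, rfl⟩ := t.exists_eq_toPrim
  have := isPreliminary_complex ρ
  obtain ⟨v, _⟩ := exists_orthonormalBasis ρ
  rw [pedersenFun_toPrim hasT0Spectrum_complex, ρ.opRank_one,
    Module.finrank_eq_card_basis v.toBasis, Fintype.card_fin]

theorem nonempty_primSpectrum_complex (hd : 1 ≤ d) : Nonempty (PrimSpectrum (MatAlg d ℂ)) := by
  let e : MatAlg d ℂ ≃⋆ₐ[ℂ] (EuclideanSpace ℂ (Fin d) →L[ℂ] EuclideanSpace ℂ (Fin d)) :=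
    Matrix.toEuclideanCLM (n := Fin d) (𝕜 := ℂ)
  have hd' : Nonempty (Fin d) := ⟨⟨0, hd⟩⟩
  refine ⟨IrrRep.toPrim
    { space := EuclideanSpace ℂ (Fin d)
      toHom := (e : MatAlg d ℂ →⋆ₙₐ[ℂ] (EuclideanSpace ℂ (Fin d) →L[ℂ] EuclideanSpace ℂ (Fin d)))
      ne_zero := ⟨e.symm 1, ?_⟩
      irreducible := fun K _ hK => ?_ }⟩
  · change e (e.symm 1) ≠ 0
    rw [e.apply_symm_apply]
    exact one_ne_zero
  · refine or_iff_not_imp_left.2 fun hne => eq_top_iff.2 fun w _ => ?_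
    obtain ⟨v, hv, hv0⟩ := K.exists_mem_ne_zero_of_ne_bot hne
    -- the rank one operator `v ↦ w` is in the range of the representation
    have := hK (e.symm (((‖v‖ : ℂ) ^ 2)⁻¹ • InnerProductSpace.rankOne ℂ w v)) v hv
    change e (e.symm _) v ∈ K at this
    rw [e.apply_symm_apply] at this
    have h2 : ((‖v‖ : ℂ) ^ 2) ≠ 0 := by simpa using hv0
    simpa [inner_self_eq_norm_sq_to_K, smul_smul, h2, hv0] using this

end Complex

end MatAlg

/-! ### Decompositions of `c₀`-sums, matrix algebras and Lazar jumps -/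

namespace c0Sum

variable {C : ℕ → Type u} [∀ n, CStarAlgebra (C n)]

/-- The coordinates of a `c₀`-sum. -/
noncomputable def coord (n : ℕ) : c0Sum C →⋆ₙₐ[ℂ] C n where
  toFun x := x.1 n
  map_smul' _ _ := rfl
  map_zero' := rfl
  map_add' _ _ := rfl
  map_mul' _ _ := rfl
  map_star' _ := rfl

theorem ext_coord {x y : c0Sum C} (h : ∀ n, coord n x = coord n y) : x = y :=
  Subtype.ext (lp.ext (funext h))

/-- The sequence with only one nonzero term. -/
noncomputable def single (n : ℕ) (c : C n) : c0Sum C :=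
  ⟨lp.single ∞ n c, by
    refine tendsto_const_nhds.congr' ?_
    filter_upwards [eventually_gt_atTop n] with m hm
    rw [lp.single_apply_ne _ _ _ hm.ne', norm_zero]⟩

theorem coord_single_self (n : ℕ) (c : C n) : coord n (single n c) = c :=
  lp.single_apply_self ∞ _ _

theorem coord_single_of_ne {n m : ℕ} (h : m ≠ n) (c : C n) : coord m (single n c) = 0 :=
  lp.single_apply_ne ∞ _ _ h

theorem tendsto_norm_coord (x : c0Sum C) : Tendsto (fun n => ‖coord n x‖) atTop (𝓝 0) := x.2

/-- The truncations of a null sequence converge to it. -/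
theorem tendsto_sum_single (x : c0Sum C) :
    Tendsto (fun N => ∑ n ∈ Finset.range N, single n (coord n x)) atTop (𝓝 x) := by
  have hc (N m : ℕ) : coord m (∑ n ∈ Finset.range N, single n (coord n x)) =
      if m < N then coord m x else 0 := by
    rw [map_sum]
    split_ifs with h
    · rw [Finset.sum_eq_single_of_mem m (Finset.mem_range.2 h) fun n _ hne =>
        coord_single_of_ne hne.symm _, coord_single_self]
    · exact Finset.sum_eq_zero fun n hn =>
        coord_single_of_ne (by rintro rfl; exact h (Finset.mem_range.1 hn)) _
  refine Metric.tendsto_atTop.2 fun ε hε => ?_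
  obtain ⟨N, hN⟩ := Metric.tendsto_atTop.1 (tendsto_norm_coord x) (ε / 2) (half_pos hε)
  refine ⟨N, fun M hM => lt_of_le_of_lt ?_ (half_lt_self hε)⟩
  rw [dist_eq_norm]
  refine lp.norm_le_of_forall_le (half_pos hε).le fun m => ?_
  change ‖coord m (_ - x)‖ ≤ _
  rw [map_sub, hc]
  split_ifs with h
  · rw [_root_.sub_self, norm_zero]
    exact (half_pos hε).le
  · have := hN m (hM.trans (not_lt.1 h))
    rw [dist_zero_right, norm_norm] at this
    rw [_root_.zero_sub, norm_neg]
    exact this.le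

theorem finite_coord_sum_single_ne_zero (x : c0Sum C) (N : ℕ) :
    {m | coord m (∑ n ∈ Finset.range N, single n (coord n x)) ≠ 0}.Finite := by
  refine (Finset.range N).finite_toSet.subset fun m hm => ?_
  by_contra h
  refine hm ?_
  rw [map_sum]
  exact Finset.sum_eq_zero fun n hn => coord_single_of_ne (by rintro rfl; exact h hn) _

/-- A `c₀`-sum has no boundary. -/
noncomputable def boundaryDecomposition (Q : Empty → Type u) [∀ j, CStarAlgebra (Q j)] :
    BoundaryDecomposition (c0Sum C) C Q where
  coord := coord
  bdry := fun j => j.elim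
  bdry_surjective j := j.elim
  exists_lift n c := ⟨single n c, coord_single_self n c, fun _ h => coord_single_of_ne h c,
    fun j => j.elim⟩
  eq_zero _ h _ := ext_coord fun n => (h n).trans (map_zero _).symm
  mem_closure x _ := mem_closure_of_tendsto (tendsto_sum_single x) (Eventually.of_forall fun N =>
    ⟨fun j => j.elim, finite_coord_sum_single_ne_zero x N⟩)
  eventually_full j := j.elim

end c0Sum

section Unitization

variable {C : ℕ → Type} [∀ n, CStarAlgebra (C n)]

/-- The coordinates of the unitization of a `c₀`-sum. -/
noncomputable def unitizationCoord (n : ℕ) : Unitization ℂ (c0Sum C) →⋆ₙₐ[ℂ] C n where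
  toFun x := algebraMap ℂ (C n) x.fst + c0Sum.coord n x.snd
  map_smul' z x := by
    rw [Unitization.fst_smul, Unitization.snd_smul, map_smul (c0Sum.coord n),
      MonoidHom.id_apply, smul_add, _root_.smul_eq_mul, map_mul,
      Algebra.smul_def z (algebraMap ℂ (C n) x.fst)]
  map_zero' := by
    rw [Unitization.fst_zero, Unitization.snd_zero, map_zero, map_zero, add_zero]
  map_add' x y := by
    rw [Unitization.fst_add, Unitization.snd_add, map_add, map_add, add_add_add_comm]
  map_mul' x y := by
    rw [Unitization.fst_mul, Unitization.snd_mul, map_add, map_add, map_mul, map_mul, map_smul,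
      map_smul, add_mul, mul_add, mul_add, Algebra.smul_def, Algebra.smul_def,
      Algebra.commutes y.fst (c0Sum.coord n x.snd)]
    abel
  map_star' x := by
    rw [Unitization.fst_star, Unitization.snd_star, map_star (c0Sum.coord n), star_add,
      algebraMap_star_comm]

/-- The scalar part in the unitization of a C*-algebra. -/
noncomputable def unitizationFst (B : Type) [NonUnitalCStarAlgebra B] :
    Unitization ℂ B →⋆ₙₐ[ℂ] ℂ where
  toFun x := x.fst
  map_smul' _ _ := rfl
  map_zero' := rfl
  map_add' _ _ := rfl
  map_mul' _ _ := rfl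
  map_star' _ := rfl

theorem unitizationCoord_apply (n : ℕ) (x : Unitization ℂ (c0Sum C)) :
    unitizationCoord n x = algebraMap ℂ (C n) x.fst + c0Sum.coord n x.snd := rfl

/-- Elements with nonzero scalar part have invertible coordinates far out. -/
theorem eventually_isUnit_unitizationCoord {x : Unitization ℂ (c0Sum C)} (hx : x.fst ≠ 0) :
    ∀ᶠ n in cofinite, IsUnit (unitizationCoord n x) := by
  rw [Nat.cofinite_eq_atTop]
  have hpos : 0 < ‖x.fst‖ := norm_pos_iff.2 hx
  filter_upwards [(c0Sum.tendsto_norm_coord x.snd).eventually (gt_mem_nhds hpos)] with n hn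
  have h1 : unitizationCoord n x =
      algebraMap ℂ (C n) x.fst * (1 - -(x.fst⁻¹ • c0Sum.coord n x.snd)) := by
    rw [unitizationCoord_apply, sub_neg_eq_add, mul_add, mul_one, ← Algebra.smul_def,
      smul_inv_smul₀ hx]
  rw [h1]
  refine ((isUnit_iff_ne_zero.2 hx).map (algebraMap ℂ (C n))).mul (isUnit_one_sub_of_norm_lt_one ?_)
  rw [norm_neg, norm_smul, norm_inv, inv_mul_lt_iff₀ hpos, mul_one]
  exact hn

/-- The boundary of the unitization of a `c₀`-sum is a single point. -/
noncomputable def unitizationDecomposition :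
    BoundaryDecomposition (Unitization ℂ (c0Sum C)) C (fun _ : Unit => ℂ) where
  coord := unitizationCoord
  bdry _ := unitizationFst _
  bdry_surjective _ z := ⟨Unitization.inl z, rfl⟩
  exists_lift n c := by
    refine ⟨((c0Sum.single n c : c0Sum C) : Unitization ℂ (c0Sum C)), ?_, fun m hm => ?_,
      fun _ => ?_⟩
    · simpa [unitizationCoord_apply] using c0Sum.coord_single_self n c
    · simpa [unitizationCoord_apply] using c0Sum.coord_single_of_ne hm c
    · rfl
  eq_zero x h h' := by
    have h0 : x.fst = 0 := h' ()
    refine Unitization.ext h0 (c0Sum.ext_coord fun n => ?_)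
    have := h n
    simpa [unitizationCoord_apply, h0] using this
  mem_closure x h := by
    have h0 : x.fst = 0 := h ()
    have hx : x = ((x.snd : c0Sum C) : Unitization ℂ (c0Sum C)) := Unitization.ext h0 rfl
    rw [hx]
    refine mem_closure_of_tendsto ((Unitization.continuous_inr (𝕜 := ℂ)).continuousAt.tendsto.comp
      (c0Sum.tendsto_sum_single x.snd)) (Eventually.of_forall fun N => ⟨fun _ => ?_, ?_⟩)
    · rfl
    · refine (c0Sum.finite_coord_sum_single_ne_zero x.snd N).subset fun m hm => ?_
      simpa [unitizationCoord_apply] using hm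
  eventually_full _ x hx := by
    have h0 : x.fst ≠ 0 := hx
    filter_upwards [eventually_isUnit_unitizationCoord h0] with n hn K hK
    obtain ⟨b, hb⟩ := hn.exists_left_inv
    rw [← hb]
    exact K.mul_mem_left _ _ hK

end Unitization

namespace MatAlg

variable {A B : Type u} [CStarAlgebra A] [CStarAlgebra B] {d : ℕ}

/-- The entrywise application of a `*`-homomorphism. -/
noncomputable def map (d : ℕ) (f : A →⋆ₙₐ[ℂ] B) : MatAlg d A →⋆ₙₐ[ℂ] MatAlg d B :=
  CStarMatrix.mapₙₐ f

@[simp] theorem entry_map (f : A →⋆ₙₐ[ℂ] B) (x : MatAlg d A) (i j : Fin d) :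
    (map d f x).entry i j = f (x.entry i j) := rfl

theorem map_eq_zero_iff (f : A →⋆ₙₐ[ℂ] B) (x : MatAlg d A) :
    map d f x = 0 ↔ ∀ i j, f (x.entry i j) = 0 := by
  constructor
  · intro h i j
    rw [← entry_map, h, entry_zero]
  · exact fun h => ext_entry h

theorem continuous_of : Continuous (of : (Fin d → Fin d → A) → MatAlg d A) := continuous_id

theorem mem_closure_of_entry {S : Set A} {x : MatAlg d A}
    (h : ∀ i j, x.entry i j ∈ closure S) :
    x ∈ closure {y : MatAlg d A | ∀ i j, y.entry i j ∈ S} := by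
  have h1 : (fun i j => x.entry i j) ∈
      closure (Set.pi Set.univ fun _ : Fin d => Set.pi Set.univ fun _ : Fin d => S) := by
    rw [closure_pi_set]
    intro i _
    rw [closure_pi_set]
    exact fun j _ => h i j
  have h2 := map_mem_closure (t := {y : MatAlg d A | ∀ i j, y.entry i j ∈ S})
    (continuous_of (A := A) (d := d)) h1 fun f hf i j => hf i trivial j trivial
  exact h2

/-- An ideal of a matrix algebra that contains an element, one of whose entries generates the
coefficient algebra as an ideal, is the whole algebra. -/
theorem one_mem_of_entry {x : MatAlg d A} {K : TwoSidedIdeal (MatAlg d A)} (hx : x ∈ K)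
    {i j : Fin d} (h : ∀ K' : TwoSidedIdeal A, x.entry i j ∈ K' → (1 : A) ∈ K') :
    (1 : MatAlg d A) ∈ K := by
  have hsingle_mul (a b : A) (i j : Fin d) :
      single i j (a * b) = single i i a * single i j b := (single_mul_single i i j a b).symm
  have hmul_single (a b : A) (i j : Fin d) :
      single i j (a * b) = single i j a * single j j b := (single_mul_single i j j a b).symm
  -- the coefficients `a` whose multiple of the `(i, j)` matrix unit lies in `K` form an ideal
  let K' : TwoSidedIdeal A := TwoSidedIdeal.mk' {a | single i j a ∈ K}
    (by
      have : single i j (0 : A) = 0 := Matrix.single_zero i j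
      rw [Set.mem_ofPred_eq, this]
      exact K.zero_mem)
    (fun {a b} ha hb => by
      have : single i j (a + b) = single i j a + single i j b := Matrix.single_add i j a b
      rw [Set.mem_ofPred_eq, this]
      exact K.add_mem ha hb)
    (fun {a} ha => by
      have : single i j (-a) = -single i j a := by
        have h := (Matrix.single_add i j (-a) a).symm
        rw [neg_add_cancel, Matrix.single_zero] at h
        exact eq_neg_of_add_eq_zero_left h
      rw [Set.mem_ofPred_eq, this]
      exact K.neg_mem ha)
    (fun {a b} hb => by
      rw [Set.mem_ofPred_eq, hsingle_mul]
      exact K.mul_mem_left _ _ hb)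
    (fun {a b} ha => by
      rw [Set.mem_ofPred_eq, hmul_single]
      exact K.mul_mem_right _ _ ha)
  have hK' (a : A) : a ∈ K' ↔ single i j a ∈ K := TwoSidedIdeal.mem_mk' _ _ _ _ _ _ _
  have h1 : single i j (1 : A) ∈ K := by
    rw [← hK']
    refine h K' ((hK' _).2 ?_)
    have := single_mul_mul_single i i j j 1 1 x
    rw [one_mul, mul_one] at this
    rw [← this]
    exact K.mul_mem_right _ _ (K.mul_mem_left _ _ hx)
  rw [one_eq_sum_single]
  refine sum_mem fun k _ => ?_
  have : single k k (1 : A) = single k i 1 * single i j 1 * single j k 1 := by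
    rw [single_mul_single, single_mul_single, one_mul, one_mul]
  rw [this]
  exact K.mul_mem_right _ _ (K.mul_mem_left _ _ h1)

/-- Matrix algebras inherit decompositions. -/
noncomputable def boundaryDecomposition {ι κ : Type} {C : ι → Type u} [∀ i, CStarAlgebra (C i)]
    {Q : κ → Type u} [∀ j, CStarAlgebra (Q j)] (D : BoundaryDecomposition A C Q) (d : ℕ) :
    BoundaryDecomposition (MatAlg d A) (fun i => MatAlg d (C i)) (fun j => MatAlg d (Q j)) where
  coord i := map d (D.coord i)
  bdry j := map d (D.bdry j)
  bdry_surjective j y := by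
    choose f hf using fun k l => D.bdry_surjective j (y.entry k l)
    exact ⟨of f, ext_entry hf⟩
  exists_lift i c := by
    choose f hf hf' hf'' using fun k l => D.exists_lift i (c.entry k l)
    exact ⟨of f, ext_entry hf, fun i' hi' => ext_entry fun k l => hf' k l i' hi',
      fun j => ext_entry fun k l => hf'' k l j⟩
  eq_zero x h h' := ext_entry fun k l => D.eq_zero _
    (fun i => (map_eq_zero_iff _ _).1 (h i) k l) fun j => (map_eq_zero_iff _ _).1 (h' j) k l
  mem_closure x h := by
    refine closure_mono ?_ (mem_closure_of_entry fun k l =>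
      D.mem_closure (x.entry k l) fun j => (map_eq_zero_iff _ _).1 (h j) k l)
    intro y hy
    refine ⟨fun j => ext_entry fun k l => (hy k l).1 j, ?_⟩
    refine (Set.finite_iUnion fun k => Set.finite_iUnion fun l => (hy k l).2).subset fun i hi => ?_
    simp only [Set.mem_ofPred_eq, ne_eq, map_eq_zero_iff, not_forall] at hi
    exact Set.mem_iUnion₂.2 hi
  eventually_full j x hx := by
    simp only [ne_eq, map_eq_zero_iff, not_forall] at hx
    obtain ⟨k, l, hkl⟩ := hx
    filter_upwards [D.eventually_full j _ hkl] with i hi K hK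
    exact one_mem_of_entry hK (i := k) (j := l) hi

/-- Matrices over a matrix algebra. -/
noncomputable def compEquiv (a b : ℕ) (A : Type u) [CStarAlgebra A] :
    MatAlg a (MatAlg b A) ≃⋆ₐ[ℂ] MatAlg (a * b) A where
  toFun x := of fun i j => (x.entry (finProdFinEquiv.symm i).1 (finProdFinEquiv.symm j).1).entry
    (finProdFinEquiv.symm i).2 (finProdFinEquiv.symm j).2
  invFun y := of fun i j => of fun k l => y.entry (finProdFinEquiv (i, k)) (finProdFinEquiv (j, l))
  left_inv x := by
    refine ext_entry fun i j => ext_entry fun k l => ?_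
    simp only [entry_of, Equiv.symm_apply_apply]
  right_inv y := by
    refine ext_entry fun i j => ?_
    simp only [entry_of, Prod.mk.eta, Equiv.apply_symm_apply]
  map_mul' x y := by
    refine ext_entry fun i j => ?_
    have hsum (f : Fin a → MatAlg b A) (k l : Fin b) :
        (∑ m, f m).entry k l = ∑ m, (f m).entry k l := by
      let g : MatAlg b A →+ A := ⟨⟨fun z => z.entry k l, rfl⟩, fun _ _ => rfl⟩
      exact map_sum g f Finset.univ
    rw [entry_mul, entry_of, entry_mul, hsum, ← finProdFinEquiv.sum_comp, Fintype.sum_prod_type]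
    refine Finset.sum_congr rfl fun m _ => ?_
    rw [entry_mul]
    refine Finset.sum_congr rfl fun n _ => ?_
    simp only [entry_of, Equiv.symm_apply_apply]
  map_add' _ _ := rfl
  map_star' _ := rfl
  map_smul' _ _ := rfl

/-- `1 × 1` matrices. -/
noncomputable def oneEquiv (A : Type u) [CStarAlgebra A] : A ≃⋆ₐ[ℂ] MatAlg 1 A :=
  CStarMatrix.toOneByOne (Fin 1) ℂ A

end MatAlg

/-- An algebra isomorphic to `C` is glued from the single algebra `C`. -/
noncomputable def StarAlgEquiv.boundaryDecomposition {A C : Type u} [NonUnitalCStarAlgebra A]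
    [CStarAlgebra C] (e : A ≃⋆ₐ[ℂ] C) (Q : Empty → Type u) [∀ j, CStarAlgebra (Q j)] :
    BoundaryDecomposition A (fun _ : Unit => C) Q where
  coord _ := (e : A →⋆ₙₐ[ℂ] C)
  bdry := fun j => j.elim
  bdry_surjective j := j.elim
  exists_lift _ c := ⟨e.symm c, e.apply_symm_apply c, fun _ h => (h rfl).elim, fun j => j.elim⟩
  eq_zero _ h _ := e.injective ((h ()).trans (map_zero e).symm)
  mem_closure _ _ := subset_closure ⟨fun j => j.elim, Set.toFinite _⟩
  eventually_full j := j.elim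

namespace LazarJump

variable {A : ℕ → Type} [∀ n, CStarAlgebra (A n)]

/-- A Lazar jump as an algebra of `2 × 2` matrices over the unitization of the `c₀`-sum. -/
noncomputable def val : LazarJump A →⋆ₙₐ[ℂ] MatAlg 2 (Unitization ℂ (c0Sum A)) where
  toFun x := (show biUnitization (c0Sum A) from x).1
  map_smul' _ _ := rfl
  map_zero' := rfl
  map_add' _ _ := rfl
  map_mul' _ _ := rfl
  map_star' _ := rfl

theorem val_injective : Function.Injective (val (A := A)) := Subtype.val_injective

theorem isInducing_val : IsInducing (val (A := A)) := IsInducing.subtypeVal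

theorem mem_range_val {y : MatAlg 2 (Unitization ℂ (c0Sum A))} :
    y ∈ Set.range (val (A := A)) ↔ ∀ k l, k ≠ l → (y.entry k l).fst = 0 := by
  constructor
  · rintro ⟨⟨x, hx⟩, rfl⟩ k l hkl
    fin_cases k <;> fin_cases l <;> first | exact (hkl rfl).elim | exact hx.1 | exact hx.2
  · intro h
    exact ⟨⟨y, h 0 1 (by decide), h 1 0 (by decide)⟩, rfl⟩

theorem fst_entry_val (x : LazarJump A) {k l : Fin 2} (h : k ≠ l) :
    ((val x).entry k l).fst = 0 := mem_range_val.1 ⟨x, rfl⟩ k l h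

/-- The two characters of a Lazar jump. -/
noncomputable def character (k : Fin 2) : LazarJump A →⋆ₙₐ[ℂ] ℂ where
  toFun x := ((val x).entry k k).fst
  map_smul' _ _ := rfl
  map_zero' := rfl
  map_add' _ _ := rfl
  map_mul' x y := by
    rw [map_mul, MatAlg.entry_mul, Fin.sum_univ_two]
    fin_cases k
    · simp [fst_entry_val x (show (0 : Fin 2) ≠ 1 by decide)]
    · simp [fst_entry_val x (show (1 : Fin 2) ≠ 0 by decide)]
  map_star' x := rfl

/-- The decomposition of the algebra of all `2 × 2` matrices over the unitization. -/
noncomputable def ambient : BoundaryDecomposition (MatAlg 2 (Unitization ℂ (c0Sum A)))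
    (fun n => MatAlg 2 (A n)) (fun _ : Unit => MatAlg 2 ℂ) :=
  MatAlg.boundaryDecomposition unitizationDecomposition 2

theorem ambient_bdry_eq_zero_iff (y : MatAlg 2 (Unitization ℂ (c0Sum A))) (j : Unit) :
    ambient.bdry j y = 0 ↔ ∀ k l, (y.entry k l).fst = 0 :=
  MatAlg.map_eq_zero_iff _ y

theorem ambient_bdry_val_eq_zero_iff (x : LazarJump A) (j : Unit) :
    ambient.bdry j (val x) = 0 ↔ ∀ k, character k x = 0 := by
  rw [ambient_bdry_eq_zero_iff]
  constructor
  · exact fun h k => h k k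
  · intro h k l
    by_cases hkl : k = l
    · exact hkl ▸ h k
    · exact fst_entry_val x hkl

/-- The boundary of a Lazar jump consists of two points. -/
noncomputable def boundaryDecomposition :
    BoundaryDecomposition (LazarJump A) (fun n => MatAlg 2 (A n)) (fun _ : Fin 2 => ℂ) where
  coord n := (ambient.coord n).comp val
  bdry := character
  bdry_surjective k z := ⟨algebraMap ℂ (LazarJump A) z, by
    have h : (val (algebraMap ℂ (LazarJump A) z)).entry k k =
        algebraMap ℂ (Unitization ℂ (c0Sum A)) z := by
      refine (Matrix.algebraMap_matrix_apply (r := z) (i := k) (j := k)).trans ?_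
      rw [if_pos rfl]
    change ((val (algebraMap ℂ (LazarJump A) z)).entry k k).fst = z
    rw [h]
    rfl⟩
  exists_lift n c := by
    obtain ⟨y, hy, hy', hy''⟩ := ambient.exists_lift n c
    have h0 := (ambient_bdry_eq_zero_iff y ()).1 (hy'' ())
    obtain ⟨x, rfl⟩ := mem_range_val.2 fun k l _ => h0 k l
    exact ⟨x, hy, hy', fun k => h0 k k⟩
  eq_zero x h h' := by
    refine val_injective ((ambient.eq_zero _ h fun j => ?_).trans (map_zero _).symm)
    exact (ambient_bdry_val_eq_zero_iff x j).2 h'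
  mem_closure x h := by
    rw [isInducing_val.closure_eq_preimage_closure_image]
    refine closure_mono ?_
      (ambient.mem_closure (val x) fun j => (ambient_bdry_val_eq_zero_iff x j).2 h)
    rintro y ⟨hy, hy'⟩
    have h0 := (ambient_bdry_eq_zero_iff y ()).1 (hy ())
    obtain ⟨z, rfl⟩ := mem_range_val.2 fun k l _ => h0 k l
    exact ⟨z, ⟨fun k => h0 k k, hy'⟩, rfl⟩
  eventually_full k x hx :=
    ambient.eventually_full () (val x) fun h => hx ((ambient_bdry_val_eq_zero_iff x ()).1 h k)

end LazarJump

/-! ### Separability -/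

section Separable

theorem MatAlg.separableSpace {A : Type u} [CStarAlgebra A] [TopologicalSpace.SeparableSpace A]
    (d : ℕ) : TopologicalSpace.SeparableSpace (MatAlg d A) :=
  inferInstanceAs (TopologicalSpace.SeparableSpace (Fin d → Fin d → A))

theorem c0Sum.continuous_single {C : ℕ → Type u} [∀ n, CStarAlgebra (C n)] (n : ℕ) :
    Continuous (c0Sum.single (C := C) n) :=
  Continuous.subtype_mk (lp.isometry_single (E := C) (p := ∞) n).continuous _

theorem c0Sum.separableSpace {C : ℕ → Type u} [∀ n, CStarAlgebra (C n)]
    [∀ n, TopologicalSpace.SeparableSpace (C n)] :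
    TopologicalSpace.SeparableSpace (c0Sum C) := by
  let T (N : ℕ) (f : ∀ n, C n) : c0Sum C := ∑ n ∈ Finset.range N, c0Sum.single n (f n)
  have hT (N : ℕ) : Continuous (T N) :=
    continuous_finsetSum _ fun n _ => (c0Sum.continuous_single n).comp (continuous_apply n)
  have hsep : TopologicalSpace.IsSeparable (⋃ N, Set.range (T N)) :=
    .iUnion fun N => TopologicalSpace.isSeparable_range (hT N)
  refine TopologicalSpace.isSeparable_univ_iff.1 (hsep.closure.mono fun x _ => ?_)
  exact mem_closure_of_tendsto (c0Sum.tendsto_sum_single x) (Eventually.of_forall fun N =>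
    Set.mem_iUnion.2 ⟨N, fun n => c0Sum.coord n x, rfl⟩)

theorem Unitization.separableSpace {B : Type} [NonUnitalCStarAlgebra B]
    [TopologicalSpace.SeparableSpace B] : TopologicalSpace.SeparableSpace (Unitization ℂ B) :=
  (Unitization.uniformEquivProd (𝕜 := ℂ) (A := B)).symm.surjective.denseRange.separableSpace
    (Unitization.uniformEquivProd (𝕜 := ℂ) (A := B)).symm.continuous

theorem LazarJump.separableSpace {A : ℕ → Type} [∀ n, CStarAlgebra (A n)]
    [∀ n, TopologicalSpace.SeparableSpace (A n)] :
    TopologicalSpace.SeparableSpace (LazarJump A) := by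
  have := c0Sum.separableSpace (C := A)
  have := Unitization.separableSpace (B := c0Sum A)
  have := MatAlg.separableSpace (A := Unitization ℂ (c0Sum A)) 2
  exact (TopologicalSpace.IsSeparable.of_separableSpace
    (biUnitization (c0Sum A) : Set (MatAlg 2 (Unitization ℂ (c0Sum A))))).separableSpace

end Separable

/-! ### The level of an algebra -/

/-- All irreducible representations are finite-dimensional, there are only countably many of them up
to equivalence, and they are determined by their kernels. -/
structure IsTameSpectrum (A : Type u) [NonUnitalCStarAlgebra A] : Prop where
  isScattered : IsScattered A
  isPreliminary : IsPreliminary A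
  hasT0Spectrum : HasT0Spectrum A

theorem BoundaryDecomposition.isTameSpectrum {A : Type u} [NonUnitalCStarAlgebra A] {ι κ : Type}
    [Countable ι] [Finite κ] {C : ι → Type u} [∀ i, CStarAlgebra (C i)] {Q : κ → Type u}
    [∀ j, CStarAlgebra (Q j)] (D : BoundaryDecomposition A C Q)
    (hC : ∀ i, IsTameSpectrum (C i)) (hQ : ∀ j, IsTameSpectrum (Q j)) : IsTameSpectrum A where
  isScattered := D.isScattered (fun i => (hC i).isScattered) fun j => (hQ j).isScattered
  isPreliminary := D.isPreliminary (fun i => (hC i).isPreliminary) fun j => (hQ j).isPreliminary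
  hasT0Spectrum := D.hasT0Spectrum (fun i => (hC i).hasT0Spectrum) fun j => (hQ j).hasT0Spectrum

/-- The dimension function of the irreducible representations, i.e. the Pedersen function of the
unit, takes values at most `d` except at points of order less than `α`, and there is a point of
order at least `α` where it is at least `d`. -/
structure HasLevel (A : Type u) [CStarAlgebra A] (α : Ordinal.{u}) (d : ℕ) : Prop where
  le (t : PrimSpectrum A) :
    pedersenFun (1 : A) t ≤ d ∨ ∃ γ < α, OrderLE (pedersenFun (1 : A)) γ t
  exists_ge : ∃ t : PrimSpectrum A,
    d ≤ pedersenFun (1 : A) t ∧ ∀ γ < α, ¬ OrderLE (pedersenFun (1 : A)) γ t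

section Level

variable {A : Type u} [CStarAlgebra A] {α : Ordinal.{u}} {d : ℕ}

theorem HasLevel.orderLE (h : HasLevel A α d) (t : PrimSpectrum A) :
    OrderLE (pedersenFun (1 : A)) α t :=
  orderLE_iff.2 ⟨Set.univ, univ_mem, d, fun s _ => (h.le s).symm⟩

theorem pedersenRank_le_of_level (hA : IsPreliminary A)
    (h : ∀ t, pedersenFun (1 : A) t ≤ d ∨ ∃ γ < α, OrderLE (pedersenFun (1 : A)) γ t) :
    pedersenRank A ≤ ((ω * α + d : Ordinal.{u}) : WithTop Ordinal.{u}) := by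
  rw [pedersenRank_eq_one]
  refine iSup_le fun t => ?_
  rcases h t with ht | ⟨γ, hγ, ht⟩
  · exact pointRank_le (orderLE_iff.2 ⟨Set.univ, univ_mem, d, fun s _ => (h s).symm⟩) ht
  · exact pointRank_le_of_lt hγ ht (pedersenFun_ne_top hA _ t) d

theorem HasLevel.pedersenRank_eq (hA : IsPreliminary A) (h : HasLevel A α d) :
    pedersenRank A = ((ω * α + d : Ordinal.{u}) : WithTop Ordinal.{u}) := by
  refine le_antisymm (pedersenRank_le_of_level hA h.le) ?_
  obtain ⟨t, ht, ht'⟩ := h.exists_ge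
  rw [pedersenRank_eq_one]
  exact (le_pointRank ht' ht).trans (le_iSup (pointRank (pedersenFun (1 : A))) t)

theorem map_one_of_surjective {B : Type u} [CStarAlgebra B] (f : A →⋆ₙₐ[ℂ] B)
    (hf : Function.Surjective f) : f 1 = 1 := by
  obtain ⟨x, hx⟩ := hf 1
  rw [← mul_one (f 1), ← hx, ← map_mul, one_mul]

namespace BoundaryDecomposition

variable {ι κ : Type} {C : ι → Type u} [∀ i, CStarAlgebra (C i)] {Q : κ → Type u}
    [∀ j, CStarAlgebra (Q j)] (D : BoundaryDecomposition A C Q)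

include D

theorem orderLE_one_incl (hA : HasT0Spectrum A) (hC : ∀ i, HasT0Spectrum (C i)) (i : ι)
    (t : PrimSpectrum (C i)) {γ : Ordinal.{u}} :
    OrderLE (pedersenFun (1 : A)) γ (D.incl i t) ↔ OrderLE (pedersenFun (1 : C i)) γ t := by
  rw [D.orderLE_incl hA hC, map_one_of_surjective _ (D.coord_surjective i)]

theorem pedersenFun_one_incl (hA : HasT0Spectrum A) (hC : ∀ i, HasT0Spectrum (C i)) (i : ι)
    (t : PrimSpectrum (C i)) :
    pedersenFun (1 : A) (D.incl i t) = pedersenFun (1 : C i) t := by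
  rw [incl, pedersenFun_comap hA (hC i), map_one_of_surjective _ (D.coord_surjective i)]

theorem pedersenFun_one_bdry (hA : HasT0Spectrum A) (hQ : ∀ j, HasT0Spectrum (Q j)) (j : κ)
    (t : PrimSpectrum (Q j)) :
    pedersenFun (1 : A) (PrimSpectrum.comap (D.bdry j) (D.bdry_surjective j) t) =
      pedersenFun (1 : Q j) t := by
  rw [pedersenFun_comap hA (hQ j), map_one_of_surjective _ (D.bdry_surjective j)]

/-- Gluing algebras of the same level along a boundary with small representations does not change
the level. -/
theorem hasLevel_of_const [Finite κ] [Nonempty ι] (hA : HasT0Spectrum A)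
    (hC : ∀ i, HasT0Spectrum (C i)) (hQ : ∀ j, HasT0Spectrum (Q j))
    (hlC : ∀ i, HasLevel (C i) α d) (hlQ : ∀ j t, pedersenFun (1 : Q j) t ≤ d) :
    HasLevel A α d where
  le t := by
    rcases D.exists_eq_incl t with ⟨i, s, rfl⟩ | ⟨j, s, rfl⟩
    · simp only [D.orderLE_one_incl hA hC, D.pedersenFun_one_incl hA hC]
      exact (hlC i).le s
    · rw [D.pedersenFun_one_bdry hA hQ]
      exact Or.inl (hlQ j s)
  exists_ge := by
    obtain ⟨i⟩ := ‹Nonempty ι›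
    obtain ⟨t, ht⟩ := (hlC i).exists_ge
    refine ⟨D.incl i t, ?_⟩
    simpa only [D.orderLE_one_incl hA hC, D.pedersenFun_one_incl hA hC] using ht

end BoundaryDecomposition

/-- If the levels of the ideals approach the ordinal `α` from below in such a way that their
dimensions are unbounded, the boundary points have order `α`. -/
theorem BoundaryDecomposition.hasLevel_of_tendsto {κ : Type} [Finite κ] [Nonempty κ]
    {C : ℕ → Type u} [∀ i, CStarAlgebra (C i)] {Q : κ → Type u} [∀ j, CStarAlgebra (Q j)]
    (D : BoundaryDecomposition A C Q) (hA : HasT0Spectrum A)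
    (hC : ∀ i, HasT0Spectrum (C i)) (hQ : ∀ j, HasT0Spectrum (Q j))
    {β : ℕ → Ordinal.{u}} {k : ℕ → ℕ} (hlC : ∀ n, HasLevel (C n) (β n) (k n))
    (hβ : ∀ n, β n < α) (hβ' : ∀ γ < α, ∀ᶠ n in atTop, γ ≤ β n) (hk : Tendsto k atTop atTop)
    (hlQ : ∀ j, HasLevel (Q j) 0 d) : HasLevel A α d where
  le t := by
    rcases D.exists_eq_incl t with ⟨i, s, rfl⟩ | ⟨j, s, rfl⟩
    · exact Or.inr ⟨β i, hβ i, (D.orderLE_one_incl hA hC i s).2 ((hlC i).orderLE s)⟩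
    · rw [D.pedersenFun_one_bdry hA hQ]
      exact Or.inl (((hlQ j).le s).resolve_right fun ⟨γ, hγ, _⟩ => not_lt_zero hγ)
  exists_ge := by
    obtain ⟨j⟩ := ‹Nonempty κ›
    obtain ⟨s, hs, _⟩ := (hlQ j).exists_ge
    refine ⟨PrimSpectrum.comap (D.bdry j) (D.bdry_surjective j) s, ?_, fun γ hγ hle => ?_⟩
    · rwa [D.pedersenFun_one_bdry hA hQ]
    -- near the boundary point there are points of order at least `γ` and of large dimension
    obtain ⟨U, hU, N, h⟩ := orderLE_iff.1 hle
    have hev := D.eventually_incl_mem hU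
    rw [Nat.cofinite_eq_atTop] at hev
    obtain ⟨n, hn, hγn, hkn⟩ :=
      (hev.and ((hβ' γ hγ).and (hk.eventually (eventually_gt_atTop N)))).exists
    obtain ⟨t, ht, ht'⟩ := (hlC n).exists_ge
    rcases h _ (hn t) with ⟨δ, hδ, hle'⟩ | hle'
    · exact ht' δ (hδ.trans_le hγn) ((D.orderLE_one_incl hA hC n t).1 hle')
    · rw [D.pedersenFun_one_incl hA hC] at hle'
      exact absurd (Nat.cast_le.1 (ht.trans hle')) (not_le.2 hkn)

theorem MatAlg.isTameSpectrum_complex (d : ℕ) : IsTameSpectrum (MatAlg d ℂ) :=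
  ⟨isScattered_complex, isPreliminary_complex, hasT0Spectrum_complex⟩

theorem MatAlg.hasLevel_complex {d : ℕ} (hd : 1 ≤ d) : HasLevel (MatAlg d ℂ) 0 d where
  le t := Or.inl (pedersenFun_one_complex t).le
  exists_ge := by
    obtain ⟨t⟩ := nonempty_primSpectrum_complex hd
    exact ⟨t, (pedersenFun_one_complex t).ge, fun γ hγ => (not_lt_zero hγ).elim⟩

end Level

section Iso

variable {A C : Type} [CStarAlgebra A] [CStarAlgebra C]

theorem IsTameSpectrum.of_equiv (e : A ≃⋆ₐ[ℂ] C) (h : IsTameSpectrum C) : IsTameSpectrum A :=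
  (e.boundaryDecomposition fun _ => ℂ).isTameSpectrum (fun _ => h) fun j => j.elim

theorem HasLevel.of_equiv (e : A ≃⋆ₐ[ℂ] C) (h : IsTameSpectrum C) {α : Ordinal.{0}} {d : ℕ}
    (hl : HasLevel C α d) : HasLevel A α d :=
  (e.boundaryDecomposition fun _ => ℂ).hasLevel_of_const (h.of_equiv e).hasT0Spectrum
    (fun _ => h.hasT0Spectrum) (fun j => j.elim) (fun _ => hl) fun j => j.elim

end Iso

theorem Complex.isTameSpectrum : IsTameSpectrum ℂ :=
  (MatAlg.isTameSpectrum_complex 1).of_equiv (MatAlg.oneEquiv ℂ)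

theorem Complex.hasLevel : HasLevel ℂ 0 1 :=
  (MatAlg.hasLevel_complex le_rfl).of_equiv (MatAlg.oneEquiv ℂ) (MatAlg.isTameSpectrum_complex 1)

/-! ### The Lazar algebras -/

section Lazar

/-- All matrix algebras over `A` have tame spectrum and the level that belongs to `α`. -/
def HasMatrixLevels (A : Type) [CStarAlgebra A] (α : Ordinal.{0}) : Prop :=
  ∀ d : ℕ, 1 ≤ d → IsTameSpectrum (MatAlg d A) ∧ HasLevel (MatAlg d A) α d

theorem LazarJump.hasMatrixLevels {A : ℕ → Type} [∀ n, CStarAlgebra (A n)] {α : Ordinal.{0}}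
    {β : ℕ → Ordinal.{0}} (hA : ∀ n, HasMatrixLevels (A n) (β n)) (hβ : ∀ n, β n < α)
    (hβ' : ∀ γ < α, ∀ᶠ n in atTop, γ ≤ β n) :
    HasMatrixLevels (LazarJump fun n => MatAlg (n + 1) (A n)) α := by
  intro d hd
  let D := MatAlg.boundaryDecomposition
    (LazarJump.boundaryDecomposition (A := fun n => MatAlg (n + 1) (A n))) d
  -- the ideals of the jump are matrix algebras over `A n`, whose sizes tend to infinity
  let e (n : ℕ) : MatAlg d (MatAlg 2 (MatAlg (n + 1) (A n))) ≃⋆ₐ[ℂ]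
      MatAlg (d * 2 * (n + 1)) (A n) :=
    (MatAlg.compEquiv d 2 (MatAlg (n + 1) (A n))).trans (MatAlg.compEquiv (d * 2) (n + 1) (A n))
  have hpos (n : ℕ) : 1 ≤ d * 2 * (n + 1) := Nat.mul_pos (by omega) n.succ_pos
  have hC (n : ℕ) : IsTameSpectrum (MatAlg d (MatAlg 2 (MatAlg (n + 1) (A n)))) :=
    (hA n _ (hpos n)).1.of_equiv (e n)
  have hlC (n : ℕ) :
      HasLevel (MatAlg d (MatAlg 2 (MatAlg (n + 1) (A n)))) (β n) (d * 2 * (n + 1)) :=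
    (hA n _ (hpos n)).2.of_equiv (e n) (hA n _ (hpos n)).1
  have hT := D.isTameSpectrum hC fun _ => MatAlg.isTameSpectrum_complex d
  have hk : Tendsto (fun n : ℕ => d * 2 * (n + 1)) atTop atTop :=
    tendsto_atTop_mono (fun n =>
      n.le_succ.trans (Nat.le_mul_of_pos_left (n + 1) (Nat.mul_pos hd two_pos))) tendsto_id
  exact ⟨hT, D.hasLevel_of_tendsto hT.hasT0Spectrum (fun n => (hC n).hasT0Spectrum)
    (fun _ => MatAlg.hasT0Spectrum_complex) hlC hβ hβ' hk fun _ => MatAlg.hasLevel_complex hd⟩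

/-- Both for successors and for limits the chosen sequence stays above any given smaller ordinal
(or equal to it) from some index on. -/
theorem IsFundamentalSystem.eventually_le {s : Ordinal.{0} → ℕ → Ordinal.{0}}
    (hs : IsFundamentalSystem s) {α : Ordinal.{0}} (hα : α < ω₁) {γ : Ordinal.{0}} (hγ : γ < α) :
    ∀ᶠ n in atTop, γ ≤ s α n := by
  rcases Ordinal.zero_or_succ_or_isSuccLimit α with rfl | ⟨δ, rfl⟩ | h
  · exact (not_lt_zero hγ).elim
  · rw [Order.succ_eq_add_one] at *
    refine Eventually.of_forall fun n => ?_
    rw [hs.succ δ ((Order.lt_add_one_iff.2 le_rfl).trans hα)]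
    exact Order.lt_add_one_iff.1 hγ
  · obtain ⟨_, ⟨n, rfl⟩, hn⟩ := (lt_isLUB_iff (hs.limit_isLUB α hα h)).1 hγ
    filter_upwards [eventually_ge_atTop n] with m hm
    exact hn.le.trans ((hs.limit_strictMono α hα h).monotone hm)

theorem lazarAlgebra_zero (s : Ordinal.{0} → ℕ → Ordinal.{0}) : lazarAlgebra s 0 = ⟨ℂ⟩ := by
  rw [lazarAlgebra, dif_neg fun h => h.1 rfl]

theorem lazarAlgebra_of_ne_zero {s : Ordinal.{0} → ℕ → Ordinal.{0}} (hs : IsFundamentalSystem s)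
    {α : Ordinal.{0}} (hα : α < ω₁) (h0 : α ≠ 0) :
    lazarAlgebra s α = ⟨LazarJump fun n => MatAlg (n + 1) (lazarAlgebra s (s α n)).carrier⟩ := by
  rw [lazarAlgebra, dif_pos ⟨h0, hs.lt hα h0⟩]

theorem lazarAlgebra_hasMatrixLevels {s : Ordinal.{0} → ℕ → Ordinal.{0}}
    (hs : IsFundamentalSystem s) (α : Ordinal.{0}) :
    α < ω₁ → HasMatrixLevels (lazarAlgebra s α).carrier α := by
  induction α using WellFoundedLT.induction with
  | _ α ih =>
    intro hα
    by_cases h0 : α = 0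
    · rw [h0, lazarAlgebra_zero]
      exact fun d hd => ⟨MatAlg.isTameSpectrum_complex d, MatAlg.hasLevel_complex hd⟩
    · rw [lazarAlgebra_of_ne_zero hs hα h0]
      exact LazarJump.hasMatrixLevels
        (fun n => ih _ (hs.lt hα h0 n) ((hs.lt hα h0 n).trans hα)) (hs.lt hα h0)
        fun γ hγ => hs.eventually_le hα hγ

theorem lazarAlgebra_separableSpace {s : Ordinal.{0} → ℕ → Ordinal.{0}}
    (hs : IsFundamentalSystem s) (α : Ordinal.{0}) :
    α < ω₁ → TopologicalSpace.SeparableSpace (lazarAlgebra s α).carrier := by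
  induction α using WellFoundedLT.induction with
  | _ α ih =>
    intro hα
    by_cases h0 : α = 0
    · rw [h0, lazarAlgebra_zero]
      exact inferInstanceAs (TopologicalSpace.SeparableSpace ℂ)
    · rw [lazarAlgebra_of_ne_zero hs hα h0]
      have (n : ℕ) : TopologicalSpace.SeparableSpace
          (MatAlg (n + 1) (lazarAlgebra s (s α n)).carrier) := by
        have := ih _ (hs.lt hα h0 n) ((hs.lt hα h0 n).trans hα)
        exact MatAlg.separableSpace _
      exact LazarJump.separableSpace

theorem lazarAlgebra_isTameSpectrum {s : Ordinal.{0} → ℕ → Ordinal.{0}}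
    (hs : IsFundamentalSystem s) {α : Ordinal.{0}} (hα : α < ω₁) :
    IsTameSpectrum (lazarAlgebra s α).carrier :=
  (lazarAlgebra_hasMatrixLevels hs α hα 1 le_rfl).1.of_equiv (MatAlg.oneEquiv _)

end Lazar

/-! ### Algebras of prescribed Fell rank -/

section FellRank

variable {X : Type} [CStarAlgebra X] {α : Ordinal.{0}} {d : ℕ}

theorem unitization_isTameSpectrum (hX : IsTameSpectrum X) :
    IsTameSpectrum (Unitization ℂ (c0Sum fun _ => X)) :=
  (unitizationDecomposition (C := fun _ => X)).isTameSpectrum (fun _ => hX)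
    fun _ => Complex.isTameSpectrum

theorem unitization_hasLevel (hX : IsTameSpectrum X) (hl : HasLevel X α d) (hd : 1 ≤ d) :
    HasLevel (Unitization ℂ (c0Sum fun _ => X)) α d := by
  refine (unitizationDecomposition (C := fun _ => X)).hasLevel_of_const
    (unitization_isTameSpectrum hX).hasT0Spectrum (fun _ => hX.hasT0Spectrum)
    (fun _ => Complex.isTameSpectrum.hasT0Spectrum) (fun _ => hl) fun _ t => ?_
  exact ((Complex.hasLevel.le t).resolve_right fun ⟨γ, hγ, _⟩ => not_lt_zero hγ).trans
    (Nat.cast_le.2 hd)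

/-- Near the point at infinity of the unitization of a constant `c₀`-sum, every element that does
not vanish there has invertible coordinates, hence the largest possible rank. -/
theorem exists_le_fellRank_unitization (hX : IsTameSpectrum X) (hl : HasLevel X α d) :
    ∃ ρ : IrrRep (Unitization ℂ (c0Sum fun _ => X)),
      ((ω * α + d : Ordinal.{0}) : WithTop Ordinal.{0}) ≤ ρ.fellRank := by
  let D := unitizationDecomposition (C := fun _ => X)
  have hT := (unitization_isTameSpectrum hX).hasT0Spectrum
  obtain ⟨s, _⟩ := Complex.hasLevel.exists_ge
  obtain ⟨σ, rfl⟩ := s.exists_eq_toPrim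
  refine ⟨IrrRep.comap (D.bdry ()) (D.bdry_surjective ()) σ, le_sInf ?_⟩
  rintro _ ⟨b, U, ⟨hU, hσU, hb⟩, rfl⟩
  have hne : b.fst ≠ 0 := by
    intro h0
    refine hb _ hσU ?_
    change σ.toHom b.fst = 0
    rw [h0, map_zero]
  have hU' : U ∈ 𝓝 (PrimSpectrum.comap (D.bdry ()) (D.bdry_surjective ()) σ.toPrim) := by
    rw [PrimSpectrum.comap_toPrim]
    exact hU.mem_nhds hσU
  obtain ⟨n, hn, hbn⟩ :=
    ((D.eventually_incl_mem hU').and (eventually_isUnit_unitizationCoord hne)).exists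
  obtain ⟨t, ht, ht'⟩ := hl.exists_ge
  calc ((ω * α + d : Ordinal.{0}) : WithTop Ordinal.{0})
      ≤ pointRank (pedersenFun (1 : X)) t := le_pointRank ht' ht
    _ = pointRank (pedersenFun (D.coord n b)) t := by
      rw [pedersenFun_eq_one_of_isUnit (a := D.coord n b) hbn]
    _ = pointRank (pedersenFun b) (D.incl n t) :=
      (D.pointRank_incl hT (fun _ => hX.hasT0Spectrum) b n t).symm
    _ ≤ sectionFellRank b U := by
      rw [sectionFellRank_eq b hU]
      exact le_iSup (fun s : U => pointRank (pedersenFun b) s.1) ⟨D.incl n t, hn t⟩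

theorem fellRank_le_pedersenRank (A : Type u) [NonUnitalCStarAlgebra A] :
    fellRank A ≤ pedersenRank A :=
  iSup_le fun ρ => ρ.fellRank_le_pedersenRank

end FellRank

/-! ### Countable ordinals and the existence of algebras of all ranks -/

section Existence

theorem lt_omega_one_iff_card_le {α : Ordinal.{0}} : α < ω₁ ↔ α.card ≤ Cardinal.aleph0 := by
  rw [← Cardinal.ord_aleph, Cardinal.lt_ord, Cardinal.lt_aleph_one_iff]

theorem countable_Iio_of_lt_omega_one {α : Ordinal.{0}} (h : α < ω₁) : (Set.Iio α).Countable := by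
  have := Cardinal.lift_le.{1}.2 (lt_omega_one_iff_card_le.1 h)
  rw [Cardinal.lift_aleph0] at this
  rw [← Set.countable_coe_iff, ← Cardinal.mk_le_aleph0_iff, Cardinal.mk_Iio_ordinal]
  exact this

theorem add_lt_omega_one {α β : Ordinal.{0}} (hα : α < ω₁) (hβ : β < ω₁) : α + β < ω₁ := by
  rw [lt_omega_one_iff_card_le] at hα hβ ⊢
  rw [Ordinal.card_add]
  exact Cardinal.add_le_aleph0.2 ⟨hα, hβ⟩

theorem one_lt_omega_one : (1 : Ordinal.{0}) < ω₁ := one_lt_omega0.trans omega0_lt_omega_one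

/-- Countable limit ordinals have cofinality `ω`. -/
theorem exists_strictMono_isLUB {α : Ordinal.{0}} (hα : α < ω₁) (h : Order.IsSuccLimit α) :
    ∃ u : ℕ → Ordinal.{0}, StrictMono u ∧ IsLUB (Set.range u) α := by
  obtain ⟨f, hf⟩ := (countable_Iio_of_lt_omega_one hα).exists_eq_range ⟨0, h.bot_lt⟩
  let u : ℕ → Ordinal.{0} := fun n => Nat.rec 0 (fun n o => max o (f n) + 1) n
  have hu (n : ℕ) : u (n + 1) = max (u n) (f n) + 1 := rfl
  have hlt (n : ℕ) : f n < u (n + 1) := (le_max_right (u n) (f n)).trans_lt (lt_add_one _)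
  refine ⟨u, strictMono_nat_of_lt_succ fun n =>
    (le_max_left (u n) (f n)).trans_lt (lt_add_one _), ?_, fun b hb => ?_⟩
  · rintro _ ⟨n, rfl⟩
    have (n : ℕ) : u n < α := by
      induction n with
      | zero => exact h.bot_lt
      | succ n ih =>
        have hfn : f n ∈ Set.Iio α := hf ▸ ⟨n, rfl⟩
        rw [hu]
        exact h.succ_lt (max_lt ih hfn)
    exact (this n).le
  · by_contra! hlt'
    obtain ⟨n, hn⟩ : b ∈ Set.range f := hf ▸ hlt'
    exact absurd (hb ⟨n + 1, rfl⟩) (not_le.2 (hn ▸ hlt n))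

theorem exists_isFundamentalSystem :
    ∃ s : Ordinal.{0} → ℕ → Ordinal.{0}, IsFundamentalSystem s := by
  have h (α : Ordinal.{0}) : ∃ u : ℕ → Ordinal.{0}, (∀ γ, α = γ + 1 → ∀ n, u n = γ) ∧
      (α < ω₁ → Order.IsSuccLimit α → StrictMono u ∧ IsLUB (Set.range u) α) := by
    rcases Ordinal.zero_or_succ_or_isSuccLimit α with rfl | ⟨δ, rfl⟩ | hl
    · refine ⟨fun _ => 0, fun γ hγ => ?_, fun _ hl => ?_⟩
      · exact ((Order.succ_ne_bot γ) hγ.symm).elim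
      · exact (hl.ne_bot rfl).elim
    · refine ⟨fun _ => δ, fun γ hγ _ => Order.succ_injective hγ, fun _ hl => ?_⟩
      exact (Order.not_isSuccLimit_succ δ hl).elim
    · have hne (γ : Ordinal.{0}) : α ≠ γ + 1 := fun hγ =>
        Order.not_isSuccLimit_succ γ (by rwa [Order.succ_eq_add_one, ← hγ])
      by_cases hα : α < ω₁
      · obtain ⟨u, hu⟩ := exists_strictMono_isLUB hα hl
        exact ⟨u, fun γ hγ => (hne γ hγ).elim, fun _ _ => hu⟩
      · exact ⟨fun _ => 0, fun γ hγ => (hne γ hγ).elim, fun h => (hα h).elim⟩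
  choose s hs hs' using h
  exact ⟨s, fun γ _ => hs _ γ rfl, fun α hα hl => (hs' α hα hl).1, fun α hα hl => (hs' α hα hl).2⟩

/-- The unitization of the `c₀`-sum of countably many copies of `L_α ⊗ M_d` has the level of
`L_α ⊗ M_d`, and its point at infinity has the largest possible Fell rank. -/
theorem exists_algebra_of_level {α : Ordinal.{0}} (hα : α < ω₁) {d : ℕ} (hd : 1 ≤ d) :
    ∃ (A : Type) (_ : CStarAlgebra A), TopologicalSpace.SeparableSpace A ∧ IsTameSpectrum A ∧
      pedersenRank A = ((ω * α + d : Ordinal.{0}) : WithTop Ordinal.{0}) ∧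
      ∃ ρ : IrrRep A, ((ω * α + d : Ordinal.{0}) : WithTop Ordinal.{0}) ≤ ρ.fellRank := by
  obtain ⟨s, hs⟩ := exists_isFundamentalSystem
  obtain ⟨hX, hl⟩ := lazarAlgebra_hasMatrixLevels hs α hα d hd
  have := lazarAlgebra_separableSpace hs α hα
  have := MatAlg.separableSpace (A := (lazarAlgebra s α).carrier) d
  have := c0Sum.separableSpace (C := fun _ => MatAlg d (lazarAlgebra s α).carrier)
  have hT := unitization_isTameSpectrum hX
  exact ⟨Unitization ℂ (c0Sum fun _ => MatAlg d (lazarAlgebra s α).carrier), inferInstance,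
    Unitization.separableSpace, hT,
    (unitization_hasLevel hX hl hd).pedersenRank_eq hT.isPreliminary,
    exists_le_fellRank_unitization hX hl⟩

/-- For successor ordinals `γ = ω * α + d` the bound `γ` is attained; for the other ordinals
the zero algebra is enough. -/
theorem exists_algebra_of_successor {γ : Ordinal.{0}} (hγ : γ < ω₁) :
    ∃ (A : Type) (_ : CStarAlgebra A), TopologicalSpace.SeparableSpace A ∧ IsTameSpectrum A ∧
      pedersenRank A ≤ γ ∧ ∀ β, γ = β + 1 → ∃ ρ : IrrRep A, γ ≤ ρ.fellRank := by
  by_cases h : ∃ β, γ = β + 1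
  · obtain ⟨β, hβ⟩ := h
    obtain ⟨d, hd⟩ := Ordinal.lt_omega0.1 (Ordinal.mod_lt γ Ordinal.omega0_ne_zero)
    have hdiv : ω * (γ / ω) + d = γ := by
      rw [← hd]
      exact Ordinal.div_add_mod γ ω
    have hd0 : 1 ≤ d := by
      rw [Nat.one_le_iff_ne_zero]
      rintro rfl
      rw [Nat.cast_zero, add_zero] at hdiv
      -- multiples of `ω` are not successors
      have hlim := Ordinal.isSuccPrelimit_mul_left (b := γ / ω) Ordinal.isSuccLimit_omega0
      rw [hdiv, hβ] at hlim
      exact Order.not_isSuccPrelimit_succ β hlim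
    obtain ⟨A, _, h1, h2, h3, h4⟩ :=
      exists_algebra_of_level
        (((Ordinal.le_mul_right _ omega0_pos).trans (Ordinal.mul_div_le γ ω)).trans_lt hγ) hd0
    rw [hdiv] at h3 h4
    exact ⟨A, _, h1, h2, h3.le, fun _ _ => h4⟩
  · refine ⟨MatAlg 0 ℂ, inferInstance, MatAlg.separableSpace 0, MatAlg.isTameSpectrum_complex 0,
      ?_, fun β hβ => (h ⟨β, hβ⟩).elim⟩
    refine (pedersenRank_le_of_level (α := 0) (d := 0) MatAlg.isPreliminary_complex
      fun t => Or.inl (MatAlg.pedersenFun_one_complex t).le).trans (WithTop.coe_le_coe.2 ?_)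
    simp

/-- The `c₀`-sum of the algebras of all smaller ranks has Pedersen rank at most `α`, while the Fell
ranks of its irreducible representations exceed every ordinal below `α`. -/
theorem exists_algebra_of_rank {α : Ordinal.{0}} (hα : α < ω₁) :
    ∃ (A : Type) (_ : NonUnitalCStarAlgebra A), TopologicalSpace.SeparableSpace A ∧
      IsTameSpectrum A ∧ pedersenRank A ≤ α ∧
      ∀ β < α, ∃ ρ : IrrRep A, β < ρ.fellRank := by
  have hcount : (Set.Iic α).Countable := by
    rw [← Order.Iio_succ]
    exact countable_Iio_of_lt_omega_one (add_lt_omega_one hα one_lt_omega_one)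
  obtain ⟨f, hf⟩ := hcount.exists_eq_range ⟨α, Set.mem_Iic.2 le_rfl⟩
  have hle (n : ℕ) : f n ≤ α := by
    have : f n ∈ Set.Iic α := hf ▸ ⟨n, rfl⟩
    exact this
  choose C _ hsep hT hP hF using fun n => exists_algebra_of_successor ((hle n).trans_lt hα)
  let D := c0Sum.boundaryDecomposition (C := C) fun _ => ℂ
  have hA := D.isTameSpectrum hT fun j => j.elim
  have hC (n : ℕ) := (hT n).hasT0Spectrum
  refine ⟨c0Sum C, inferInstance, c0Sum.separableSpace, hA, ?_, fun β hβ => ?_⟩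
  · refine iSup_le fun a => iSup_le fun t => ?_
    rcases D.exists_eq_incl t with ⟨n, s, rfl⟩ | ⟨j, _, _⟩
    · rw [D.pointRank_incl hA.hasT0Spectrum hC]
      exact (le_iSup (pointRank (pedersenFun (D.coord n a))) s).trans
        ((le_iSup elementPedersenRank (D.coord n a)).trans
          ((hP n).trans (WithTop.coe_le_coe.2 (hle n))))
    · exact j.elim
  · have hmem : β + 1 ∈ Set.Iic α := Order.add_one_le_of_lt hβ
    obtain ⟨n, hn⟩ : β + 1 ∈ Set.range f := hf ▸ hmem
    obtain ⟨σ, hσ⟩ := hF n β hn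
    refine ⟨_, lt_of_lt_of_le ?_ (hσ.trans (D.fellRank_le_comap hA.hasT0Spectrum hC n σ))⟩
    rw [hn]
    exact WithTop.coe_lt_coe.2 (lt_add_one β)

end Existence

theorem mainTheorem3 (α : Ordinal.{0}) (hα : α < ω₁) :
    (∃ (A : Type) (_ : NonUnitalCStarAlgebra A),
      TopologicalSpace.SeparableSpace A ∧ IsScattered A ∧ IsPreliminary A ∧
      IsTypeI A α ∧ ∀ β < α, ¬ IsTypeI A β) ∧
    (∃ (A : Type) (_ : NonUnitalCStarAlgebra A),
      TopologicalSpace.SeparableSpace A ∧ IsScattered A ∧ IsPreliminary A ∧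
      IsSubhomogeneous A α ∧ ∀ β < α, ¬ IsSubhomogeneous A β) ∧
    (∀ s : Ordinal.{0} → ℕ → Ordinal.{0}, IsFundamentalSystem s →
      TopologicalSpace.SeparableSpace (lazarAlgebra s α).carrier ∧
      IsScattered (lazarAlgebra s α).carrier ∧ IsPreliminary (lazarAlgebra s α).carrier ∧
      ∀ d : ℕ, 1 ≤ d →
        pedersenRank (MatAlg d (lazarAlgebra s α).carrier) =
          ((ω * α + d : Ordinal.{0}) : WithTop Ordinal.{0})) ∧
    (∀ d : ℕ, 1 ≤ d → ∃ (A : Type) (_ : CStarAlgebra A),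
      TopologicalSpace.SeparableSpace A ∧ IsScattered A ∧ IsPreliminary A ∧
      fellRank A = ((ω * α + d : Ordinal.{0}) : WithTop Ordinal.{0}) ∧
      pedersenRank A = ((ω * α + d : Ordinal.{0}) : WithTop Ordinal.{0})) := by
  refine ⟨?_, ?_, fun s hs => ?_, fun d hd => ?_⟩
  · obtain ⟨A, _, hsep, hT, hP, hF⟩ := exists_algebra_of_rank (add_lt_omega_one one_lt_omega_one hα)
    refine ⟨A, _, hsep, hT.isScattered, hT.isPreliminary, isTypeI_of_pedersenRank_le hP,
      fun β hβ => ?_⟩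
    obtain ⟨ρ, hρ⟩ := hF (1 + β) (by gcongr)
    exact fellIdeal_ne_univ hρ
  · obtain ⟨A, _, hsep, hT, hP, hF⟩ := exists_algebra_of_rank hα
    refine ⟨A, _, hsep, hT.isScattered, hT.isPreliminary, hP, fun β hβ hle => ?_⟩
    obtain ⟨ρ, hρ⟩ := hF β hβ
    exact absurd (hρ.trans_le (ρ.fellRank_le_pedersenRank.trans hle)) (lt_irrefl _)
  · have hT := lazarAlgebra_isTameSpectrum hs hα
    refine ⟨lazarAlgebra_separableSpace hs α hα, hT.isScattered, hT.isPreliminary, fun d hd => ?_⟩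
    obtain ⟨hX, hl⟩ := lazarAlgebra_hasMatrixLevels hs α hα d hd
    exact hl.pedersenRank_eq hX.isPreliminary
  · obtain ⟨A, _, hsep, hT, hP, ρ, hρ⟩ := exists_algebra_of_level hα hd
    refine ⟨A, _, hsep, hT.isScattered, hT.isPreliminary, le_antisymm ?_ ?_, hP⟩
    · exact (fellRank_le_pedersenRank A).trans hP.le
    · exact hρ.trans (le_iSup IrrRep.fellRank ρ)
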